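/- Let $n>2$ and write $x\in\mathbb R^{n+1}$ as $x=(x',x_{n+1})$ with $x'\in\mathbb R^n$. Let $S^n$ be the unit sphere of $\mathbb R^{n+1}$ and $S^{n-1}$ the unit sphere of $\mathbb R^n$, and let $d\theta$ be the (unnormalized) surface measure on $S^{n-1}$. For a function $f$ on $S^n$, its vertical slice transform is $$(Vf)(\theta,t)=\int_{\{x\in S^n:\ \theta\cdot x'=t\}} f(x)\,d\sigma_{\theta,t}(x),\qquad \theta\in S^{n-1},\ t\in(-1,1),$$ where $d\sigma_{\theta,t}$ is the induced surface measure on the slice; put $(Vf)(\theta,t)=0$ for $|t|\ge 1$. Put $$\lambda_n=\frac{(-1)^{\lfloor n/2-1\rfloor}\,\Gamma((n-1)/2)\,\Gamma(n/2)}{8\,\pi^{n-1/2}\,(n-2)!},$$ and let $\Delta=\partial_1^2+\dots+\partial_n^2$ be the Laplacian in $x'\in\mathbb R^n$. Let $f$ be a real- or complex-valued infinitely differentiable function on $S^n$ which is even in $x_{n+1}$, that is $f(x',-x_{n+1})=f(x',x_{n+1})$, and which vanishes identically in some neighborhood of the equator $\{x_{n+1}=0\}$. Then $f$ is reconstructed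 from $Vf$ as follows. (i) If $n$ is odd, then for all $x\in S^n$ $$f(x)=\lambda_n\,|x_{n+1}|\,(-\Delta)\int_{S^{n-1}}\Big(\frac{d}{dt}\Big)^{n-3}\Big[(Vf)(\theta,t)\,(1-t^2)^{-1/2}\Big]\Big|_{t=\theta\cdot x'}\,d\theta .$$ (ii) If $n$ is even, then for all $x\in S^n$ $$f(x)=\frac{\lambda_n}{\pi}\,|x_{n+1}|\,\Delta\int_{S^{n-1}}\int_{-1}^{1}\Big(\frac{d}{dt}\Big)^{n-2}\Big[(Vf)(\theta,t)\,(1-t^2)^{-1/2}\Big]\,\log|t-\theta\cdot x'|\,dt\,d\theta .$$ All operations here are well defined: with $(Vf)(\theta,t)(1-t^2)^{-1/2}$ read as $0$ for $|t|\ge1$, it is an infinitely differentiable function of $t\in\mathbb R$ for every $\theta$, the integrals converge for every $x'\in\mathbb R^n$, and the function of $x'$ to which $\Delta$ is applied is twice continuously differentiable on $\mathbb R^n$. -/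

import Mathlib

open MeasureTheory Metric InnerProductSpace
open scoped Manifold ContDiff EuclideanSpace

noncomputable section

namespace VerticalSlice

/-- The horizontal part `x'` of `x = (x', x_{n+1})`. -/
def horizontalPart {n : ℕ} (x : EuclideanSpace ℝ (Fin (n + 1))) : EuclideanSpace ℝ (Fin n) :=
  WithLp.toLp 2 (fun i => x i.castSucc)

/-- The point `(p, 0)` of `ℝ^{n+1}` for `p` in `ℝ^n`. -/
def horizontalLift {n : ℕ} (p : EuclideanSpace ℝ (Fin n)) : EuclideanSpace ℝ (Fin (n + 1)) :=
  WithLp.toLp 2 (Fin.snoc (α := fun _ => ℝ) (fun i => p i) 0)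

/-- The (unnormalized) Riemannian surface measure on the unit sphere of a Euclidean space. -/
def surfaceMeasure (E : Type*) [NormedAddCommGroup E] [InnerProductSpace ℝ E]
    [FiniteDimensional ℝ E] [MeasurableSpace E] [BorelSpace E] : Measure (sphere (0 : E) 1) :=
  (volume : Measure E).toSphere

/-- The space of infinitely differentiable functions on `S^n` that are even in the last variable
and vanish identically in some neighborhood of the equator `x_{n+1} = 0`. -/
structure IsSmoothEvenVanishing {𝕜 : Type*} [RCLike 𝕜] {n : ℕ}
    (f : sphere (0 : EuclideanSpace ℝ (Fin (n + 1))) 1 → 𝕜) : Prop where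
  smooth : ContMDiff (𝓡 n) 𝓘(ℝ, 𝕜) ∞ f
  even : ∀ x y : sphere (0 : EuclideanSpace ℝ (Fin (n + 1))) 1,
    horizontalPart x.1 = horizontalPart y.1 → x.1 (Fin.last n) = -y.1 (Fin.last n) → f x = f y
  vanishing : ∃ U : Set (sphere (0 : EuclideanSpace ℝ (Fin (n + 1))) 1),
    IsOpen U ∧ {x | x.1 (Fin.last n) = 0} ⊆ U ∧ ∀ x ∈ U, f x = 0

/-- The induced surface measure on the vertical slice `{x ∈ S^n : θ · x' = t}`, regarded as a
measure on `S^n`.  With `v = (θ, 0)`, for `-1 < t < 1` the slice is the sphere with center `t v`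
and radius `√(1 - t²)` in the hyperplane `t v + v^⊥`; its surface measure is `(1 - t²)^{(n-1)/2}`
times the image of the surface measure of the unit sphere of the `n`-dimensional Euclidean space
`v^⊥` under `w ↦ t v + √(1 - t²) w`.  The measure is zero when `|t| ≥ 1` (and `n ≥ 2`). -/
def sliceMeasure {n : ℕ} (θ : sphere (0 : EuclideanSpace ℝ (Fin n)) 1) (t : ℝ) :
    Measure (sphere (0 : EuclideanSpace ℝ (Fin (n + 1))) 1) :=
  Measure.comap Subtype.val
    (ENNReal.ofReal (√(1 - t ^ 2) ^ (n - 1)) •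
      Measure.map
        (fun w : sphere (0 : (ℝ ∙ horizontalLift θ.1)ᗮ) 1 =>
          t • horizontalLift θ.1 +
            √(1 - t ^ 2) • ((w : (ℝ ∙ horizontalLift θ.1)ᗮ) : EuclideanSpace ℝ (Fin (n + 1))))
        (surfaceMeasure (ℝ ∙ horizontalLift θ.1)ᗮ))

/-- The vertical slice transform `(Vf)(θ, t)`: the integral of `f` over the slice
`{x ∈ S^n : θ · x' = t}` against the induced surface measure. -/
def verticalSlice {𝕜 : Type*} [RCLike 𝕜] {n : ℕ}
    (f : sphere (0 : EuclideanSpace ℝ (Fin (n + 1))) 1 → 𝕜)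
    (θ : sphere (0 : EuclideanSpace ℝ (Fin n)) 1) (t : ℝ) : 𝕜 :=
  ∫ x, f x ∂(sliceMeasure θ t)

/-- The weighted data `t ↦ G(θ, t) (1 - t²)^{-1/2}`. -/
def weighted {𝕜 : Type*} [RCLike 𝕜] {n : ℕ}
    (G : sphere (0 : EuclideanSpace ℝ (Fin n)) 1 → ℝ → 𝕜)
    (θ : sphere (0 : EuclideanSpace ℝ (Fin n)) 1) (t : ℝ) : 𝕜 :=
  (√(1 - t ^ 2))⁻¹ • G θ t

/-- The inner function for odd `n`: `(d/dt)^{n-3} [G(θ, t) (1 - t²)^{-1/2}]` at the point `s`. -/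
def oddKernel {𝕜 : Type*} [RCLike 𝕜] {n : ℕ}
    (G : sphere (0 : EuclideanSpace ℝ (Fin n)) 1 → ℝ → 𝕜)
    (θ : sphere (0 : EuclideanSpace ℝ (Fin n)) 1) (s : ℝ) : 𝕜 :=
  iteratedDeriv (n - 3) (weighted G θ) s

/-- The integrand for even `n`: `(d/dt)^{n-2} [G(θ, t) (1 - t²)^{-1/2}] log |t - s|`. -/
def evenIntegrand {𝕜 : Type*} [RCLike 𝕜] {n : ℕ}
    (G : sphere (0 : EuclideanSpace ℝ (Fin n)) 1 → ℝ → 𝕜)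
    (θ : sphere (0 : EuclideanSpace ℝ (Fin n)) 1) (s t : ℝ) : 𝕜 :=
  Real.log |t - s| • iteratedDeriv (n - 2) (weighted G θ) t

/-- The inner function for even `n`: the integral of the above over `-1 < t < 1`. -/
def evenKernel {𝕜 : Type*} [RCLike 𝕜] {n : ℕ}
    (G : sphere (0 : EuclideanSpace ℝ (Fin n)) 1 → ℝ → 𝕜)
    (θ : sphere (0 : EuclideanSpace ℝ (Fin n)) 1) (s : ℝ) : 𝕜 :=
  ∫ t in (-1 : ℝ)..1, evenIntegrand G θ s t

/-- The integral `∫_{S^{n-1}} K(θ, θ · p) dθ` (unnormalized surface measure), `p ∈ ℝ^n`. -/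
def backprojection {𝕜 : Type*} [RCLike 𝕜] {n : ℕ}
    (K : sphere (0 : EuclideanSpace ℝ (Fin n)) 1 → ℝ → 𝕜) (p : EuclideanSpace ℝ (Fin n)) : 𝕜 :=
  ∫ θ : sphere (0 : EuclideanSpace ℝ (Fin n)) 1, K θ (inner ℝ θ.1 p)
    ∂(surfaceMeasure (EuclideanSpace ℝ (Fin n)))

/-- The constant
`λ_n = (-1)^{[n/2-1]} Γ((n-1)/2) Γ(n/2) / (8 π^{n-1/2} (n-2)!)`. -/
def inversionConst (n : ℕ) : ℝ :=
  (-1) ^ (n / 2 - 1) * Real.Gamma (((n : ℝ) - 1) / 2) * Real.Gamma ((n : ℝ) / 2) /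
    (8 * Real.pi ^ ((n : ℝ) - 1 / 2) * ((n - 2).factorial : ℝ))

end VerticalSlice

end

/-! The problem is Radon inversion in disguise. Project the upper hemisphere to the unit ball of ℝ^n
and put φ(p) = f(p, √(1-|p|²)) / √(1-|p|²), extended by zero. As f vanishes near the equator, φ is
smooth with compact support inside the ball. The slice θ·x' = t projects to the part of the
hyperplane θ·p = t in the ball. Comparing the surface measures there and using evenness gives
(Vf)(θ,t)(1-t²)^{-1/2} = 2 Rφ(θ,t), with R the Radon transform
(`IsSmoothEvenVanishing.weighted_verticalSlice_eq`). Also f(x) = |x_{n+1}| φ(x'), so it remains to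
recover φ.

By the Fourier slice theorem (`fourier_radon`) the transform of Rφ(θ,·) at r is φ̂(rθ). For odd n,
n-3 derivatives multiply it by (2πi)^{n-3}|r|^{n-3}, since n-3 is even. For even n the power of r
would carry a sign; the logarithm repairs this: tested against second derivatives, log|t| has
Fourier transform -1/(2|r|), so pairing it with g'' produces 2π²|r|ĝ (`integral_abs_mul_fourier`).
Either way the inner function is c · ∫ |r|^{n-3} φ̂(rθ) e^{2πirs} dr, that is, c times `rieszRay`.

Integrated over θ, this is polar integration of |ξ|^{-2} φ̂(ξ) e^{2πiξ·p} with every ξ counted twice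
(`integral_rieszRay`). The singularity is integrable because n ≥ 3. The Laplacian multiplies by
-4π²|ξ|² and cancels it, so the result is -8π²c φ (`backprojection_const_mul_rieszRay`). The
duplication formula for Γ reduces λ_n to (-1)^{⌊n/2-1⌋} / (4(2π)^{n-1}), which matches c in both
parities (`inversionConst_mul`).

The Fourier argument needs complex values. A general scalar field is embedded into ℂ and the result
is mapped back. -/

namespace VerticalSlice

open Set

/-! ### Volume, cones and surface measure -/

section Measure

variable {A B W : Type*}
  [NormedAddCommGroup A] [InnerProductSpace ℝ A] [FiniteDimensional ℝ A]
  [MeasurableSpace A] [BorelSpace A]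
  [NormedAddCommGroup B] [InnerProductSpace ℝ B] [FiniteDimensional ℝ B]
  [MeasurableSpace B] [BorelSpace B]
  [NormedAddCommGroup W] [InnerProductSpace ℝ W] [FiniteDimensional ℝ W]
  [MeasurableSpace W] [BorelSpace W]

/-- Two complementary orthogonal isometric embeddings split the volume into a product. -/
theorem measurePreserving_orthogonal_add (ι : A →ₗᵢ[ℝ] W) (κ : B →ₗᵢ[ℝ] W)
    (h : ∀ a b, inner ℝ (ι a) (κ b) = 0)
    (hd : Module.finrank ℝ A + Module.finrank ℝ B = Module.finrank ℝ W) :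
    MeasurePreserving (fun p : A × B => ι p.1 + κ p.2) volume volume := by
  -- Orthogonality gives an isometry from the L² product; the dimension count makes it an
  -- equivalence, and linear isometry equivalences preserve volume.
  let L : WithLp 2 (A × B) →ₗᵢ[ℝ] W :=
    { toLinearMap := (ι.toLinearMap.coprod κ.toLinearMap) ∘ₗ
        (WithLp.linearEquiv 2 ℝ (A × B)).toLinearMap
      norm_map' := fun x => by
        have h1 : ‖ι x.fst + κ x.snd‖ ^ 2 = ‖x.fst‖ ^ 2 + ‖x.snd‖ ^ 2 := by
          rw [norm_add_sq_real, h]; simp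
        rw [WithLp.prod_norm_eq_of_L2, ← h1, Real.sqrt_sq (norm_nonneg _)]
        rfl }
  have hf : Module.finrank ℝ (WithLp 2 (A × B)) = Module.finrank ℝ W := by
    rw [← hd, ← Module.finrank_prod]
    exact (WithLp.linearEquiv 2 ℝ (A × B)).finrank_eq
  have h2 := (L.toLinearIsometryEquiv hf).measurePreserving.comp
    (WithLp.volume_preserving_toLp (U := A) (V := B))
  exact h2

/-- The surface measure of the unit sphere in terms of the normalization map on the unit ball. -/
theorem map_surfaceMeasure_eq [Nontrivial W] :
    (surfaceMeasure W).map Subtype.val = (Module.finrank ℝ W : ENNReal) •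
      ((volume : Measure W).restrict (ball 0 1)).map (fun x => ‖x‖⁻¹ • x) := by
  have hm : Measurable (fun x : W => ‖x‖⁻¹ • x) := by fun_prop
  ext s hs
  rw [Measure.map_apply measurable_subtype_coe hs, Measure.smul_apply, Measure.map_apply hm hs,
    surfaceMeasure, Measure.toSphere_apply' _ (measurable_subtype_coe hs), smul_eq_mul,
    Measure.restrict_apply (hm hs)]
  congr 1
  -- `toSphere` measures a set by the open cone over it, which misses the origin, while
  -- normalization sends 0 to 0; so the two sets differ at most by that null point.
  have h0 : (volume : Measure W) {0} = 0 := measure_singleton _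
  rw [← measure_sdiff_null h0 (s := (fun x : W => ‖x‖⁻¹ • x) ⁻¹' s ∩ ball 0 1)]
  congr 1
  ext x
  simp only [Set.mem_smul, mem_image, mem_preimage, mem_sdiff, mem_inter_iff, mem_singleton_iff,
    mem_ball_zero_iff]
  constructor
  · rintro ⟨r, ⟨hr0, hr1⟩, _, ⟨w, hw, rfl⟩, rfl⟩
    have hn : ‖r • (w : W)‖ = r := by
      rw [norm_smul, norm_eq_of_mem_sphere, mul_one, Real.norm_of_nonneg hr0.le]
    rw [hn]
    refine ⟨⟨?_, hr1⟩, ?_⟩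
    · rwa [smul_smul, inv_mul_cancel₀ hr0.ne', one_smul]
    · intro h
      rw [h, norm_zero] at hn
      exact hr0.ne hn
  · rintro ⟨⟨hs', h1⟩, hx⟩
    have hx' : 0 < ‖x‖ := norm_pos_iff.2 hx
    refine ⟨‖x‖, ⟨hx', h1⟩, ‖x‖⁻¹ • x, ⟨⟨‖x‖⁻¹ • x, ?_⟩, hs', rfl⟩, ?_⟩
    · rw [mem_sphere_zero_iff_norm, norm_smul, norm_inv, norm_norm, inv_mul_cancel₀ hx'.ne']
    · rw [smul_smul, mul_inv_cancel₀ hx'.ne', one_smul]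

/-- The substitution `s = √(r² - a²)` on the half-line. -/
theorem lintegral_Ioi_sqrt_sub_sq {a : ℝ} (ha : 0 ≤ a) (g : ℝ → ENNReal) :
    ∫⁻ s in Ioi 0, g s =
      ∫⁻ r in Ioi a, ENNReal.ofReal (r / √(r ^ 2 - a ^ 2)) * g (√(r ^ 2 - a ^ 2)) := by
  have hpos : ∀ r ∈ Ioi a, 0 < r ^ 2 - a ^ 2 := fun r (hr : a < r) => by nlinarith
  have himg : (fun r : ℝ => √(r ^ 2 - a ^ 2)) '' Ioi a = Ioi 0 := by
    ext s
    simp only [mem_image, mem_Ioi]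
    constructor
    · rintro ⟨r, hr, rfl⟩
      exact Real.sqrt_pos.2 (hpos r hr)
    · intro hs
      refine ⟨√(s ^ 2 + a ^ 2), Real.lt_sqrt_of_sq_lt (by nlinarith), ?_⟩
      rw [Real.sq_sqrt (by positivity), add_sub_cancel_right, Real.sqrt_sq hs.le]
  rw [← himg, lintegral_image_eq_lintegral_abs_deriv_mul (s := Ioi a)
    (f' := fun r => r / √(r ^ 2 - a ^ 2)) measurableSet_Ioi]
  · refine setLIntegral_congr_fun measurableSet_Ioi fun r hr => ?_
    have : 0 ≤ r := ha.trans (le_of_lt hr)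
    have : 0 ≤ r / √(r ^ 2 - a ^ 2) := by positivity
    rw [abs_of_nonneg this]
  · intro r hr
    have h1 : HasDerivAt (fun r : ℝ => r ^ 2 - a ^ 2) (2 * r) r := by
      simpa using (hasDerivAt_pow 2 r).sub_const (a ^ 2)
    have h2 := h1.sqrt (hpos r hr).ne'
    rw [mul_div_mul_left _ _ two_ne_zero] at h2
    exact h2.hasDerivWithinAt
  · intro r hr r' hr' h
    have h1 := (Real.sqrt_inj (hpos r hr).le (hpos r' hr').le).1 h
    have h2 : 0 < r := ha.trans_lt hr
    have h3 : 0 < r' := ha.trans_lt hr'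
    nlinarith

theorem lintegral_eq_pow_mul_lintegral_smul (g : A → ENNReal) {r : ℝ} (hr : 0 < r) :
    ∫⁻ y, g y = ENNReal.ofReal (r ^ Module.finrank ℝ A) * ∫⁻ u, g (r • u) := by
  have he : MeasurableEmbedding (fun u : A => r • u) :=
    (Homeomorph.smulOfNeZero r hr.ne').measurableEmbedding
  rw [← he.lintegral_map, Measure.map_addHaar_smul _ hr.ne', lintegral_smul_measure, smul_eq_mul,
    ← mul_assoc, ← ENNReal.ofReal_mul (by positivity), abs_of_pos (by positivity),
    mul_inv_cancel₀ (by positivity), ENNReal.ofReal_one, one_mul]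

end Measure

/-! ### The hemisphere as a graph over the equatorial ball -/

section Hemisphere

variable {A W : Type*}
  [NormedAddCommGroup A] [InnerProductSpace ℝ A] [FiniteDimensional ℝ A]
  [MeasurableSpace A] [BorelSpace A]
  [NormedAddCommGroup W] [InnerProductSpace ℝ W] [FiniteDimensional ℝ W]
  [MeasurableSpace W] [BorelSpace W]

/-- No charts or Jacobians of graphs are needed: surface measure is dim W times the volume of cones,
so the left side is a volume integral over a half-ball of a function that is constant along rays.
Write x = ι y + s e, replace s by r = |x|, exchange the integrals and rescale y = r u. The radial
integral ∫ r^{dim A} dr = 1 / dim W cancels the factor. -/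
theorem lintegral_upper_hemisphere (ι : A →ₗᵢ[ℝ] W) {e : W} (he : ‖e‖ = 1)
    (h : ∀ a, inner ℝ (ι a) e = 0)
    (hd : Module.finrank ℝ A + 1 = Module.finrank ℝ W) {F : W → ENNReal} (hF : Measurable F) :
    ∫⁻ w in {w | 0 < inner ℝ w e}, F w ∂((surfaceMeasure W).map Subtype.val) =
      ∫⁻ u in ball (0 : A) 1, ENNReal.ofReal (√(1 - ‖u‖ ^ 2))⁻¹ *
        F (ι u + √(1 - ‖u‖ ^ 2) • e) := by
  have : Nontrivial W := ⟨e, 0, by rintro rfl; simp at he⟩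
  have hSm : MeasurableSet {w : W | 0 < inner ℝ w e} :=
    measurableSet_lt measurable_const (by fun_prop)
  set S : Set W := {w | 0 < inner ℝ w e} with hS
  have hee : inner ℝ e e = 1 := by rw [real_inner_self_eq_norm_sq, he, one_pow]
  have hmem : ∀ (y : A) (s : ℝ), ι y + s • e ∈ S ↔ 0 < s := fun y s => by
    rw [hS, mem_ofPred_eq, inner_add_left, h, real_inner_smul_left, hee, zero_add, mul_one]
  have hnorm : ∀ (y : A) (s : ℝ), ‖ι y + s • e‖ ^ 2 = ‖y‖ ^ 2 + s ^ 2 := fun y s => by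
    rw [norm_add_sq_real, inner_smul_right, h, norm_smul, he]; simp
  set G : W → ENNReal := (ball 0 1).indicator (fun x => S.indicator F (‖x‖⁻¹ • x)) with hG
  have hGm : Measurable G := by
    refine Measurable.indicator ?_ measurableSet_ball
    exact (hF.indicator hSm).comp (by fun_prop)
  have h1 : ∫⁻ w in S, F w ∂((surfaceMeasure W).map Subtype.val) =
      (Module.finrank ℝ W : ENNReal) * ∫⁻ x, G x := by
    rw [← lintegral_indicator hSm, map_surfaceMeasure_eq, lintegral_smul_measure, smul_eq_mul,
      lintegral_map (hF.indicator hSm) (by fun_prop), hG, lintegral_indicator measurableSet_ball]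
  -- The integrand after the substitution s = √(r² - |y|²), with Jacobian r / √(r² - |y|²).
  set K : A → ℝ → ENNReal := fun y r => {p : A × ℝ | ‖p.1‖ < p.2}.indicator
    (fun p => ENNReal.ofReal (p.2 / √(p.2 ^ 2 - ‖p.1‖ ^ 2)) *
      F (p.2⁻¹ • (ι p.1 + √(p.2 ^ 2 - ‖p.1‖ ^ 2) • e))) (y, r) with hK
  have hKm : Measurable (Function.uncurry K) := by
    have : Function.uncurry K = {p : A × ℝ | ‖p.1‖ < p.2}.indicator
        (fun p => ENNReal.ofReal (p.2 / √(p.2 ^ 2 - ‖p.1‖ ^ 2)) *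
          F (p.2⁻¹ • (ι p.1 + √(p.2 ^ 2 - ‖p.1‖ ^ 2) • e))) := by ext p; rfl
    rw [this]
    have hι : Measurable ι := ι.continuous.measurable
    refine Measurable.indicator (Measurable.mul (by fun_prop) (hF.comp ?_))
      (measurableSet_lt (by fun_prop) (by fun_prop))
    exact (by fun_prop : Measurable fun p : A × ℝ => p.2⁻¹).smul
      ((hι.comp measurable_fst).add (by fun_prop))
  have h2 (y : A) : ∫⁻ s : ℝ, G (ι y + s • e) = ∫⁻ r in Ioo 0 1, K y r := by
    have h3 : ∫⁻ s : ℝ, G (ι y + s • e) = ∫⁻ s in Ioi (0 : ℝ), G (ι y + s • e) := by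
      rw [← lintegral_indicator measurableSet_Ioi]
      refine lintegral_congr fun s => ?_
      by_cases hs : 0 < s
      · rw [indicator_of_mem (show s ∈ Ioi 0 from hs)]
      · rw [indicator_of_notMem (show s ∉ Ioi 0 from hs), hG]
        refine indicator_apply_eq_zero.2 fun _ => indicator_of_notMem ?_ _
        have : ‖ι y + s • e‖⁻¹ • (ι y + s • e) =
            ι (‖ι y + s • e‖⁻¹ • y) + (‖ι y + s • e‖⁻¹ * s) • e := by
          rw [smul_add, map_smul, smul_smul]
        rw [this, hmem]
        push Not at hs ⊢
        exact mul_nonpos_of_nonneg_of_nonpos (by positivity) hs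
    rw [h3, lintegral_Ioi_sqrt_sub_sq (norm_nonneg y), ← lintegral_indicator measurableSet_Ioi,
      ← lintegral_indicator measurableSet_Ioo]
    refine lintegral_congr fun r => ?_
    by_cases hr : ‖y‖ < r
    · have hr0 : 0 < r := (norm_nonneg y).trans_lt hr
      have hd0 : 0 < r ^ 2 - ‖y‖ ^ 2 := by nlinarith [norm_nonneg y]
      have hn : ‖ι y + √(r ^ 2 - ‖y‖ ^ 2) • e‖ = r := by
        rw [← Real.sqrt_sq (norm_nonneg (ι y + _)), hnorm, Real.sq_sqrt hd0.le,
          add_sub_cancel, Real.sqrt_sq hr0.le]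
      rw [indicator_of_mem (show r ∈ Ioi ‖y‖ from hr)]
      by_cases hr1 : r < 1
      · rw [indicator_of_mem (show r ∈ Ioo 0 1 from ⟨hr0, hr1⟩), hK]
        simp only
        rw [indicator_of_mem (show (y, r) ∈ {p : A × ℝ | ‖p.1‖ < p.2} from hr), hG,
          indicator_of_mem (by rw [mem_ball_zero_iff, hn]; exact hr1), hn, indicator_of_mem]
        rw [smul_add, ← map_smul, smul_smul, hmem]
        have := Real.sqrt_pos.2 hd0
        positivity
      · rw [indicator_of_notMem (show r ∉ Ioo 0 1 from fun h => hr1 h.2), hG,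
          indicator_of_notMem (by rw [mem_ball_zero_iff, hn]; exact hr1), mul_zero]
    · rw [indicator_of_notMem (show r ∉ Ioi ‖y‖ from hr), eq_comm]
      refine indicator_apply_eq_zero.2 fun _ => ?_
      exact indicator_of_notMem (show (y, r) ∉ {p : A × ℝ | ‖p.1‖ < p.2} from hr) _
  set C := ∫⁻ u in ball (0 : A) 1, ENNReal.ofReal (√(1 - ‖u‖ ^ 2))⁻¹ *
        F (ι u + √(1 - ‖u‖ ^ 2) • e) with hC
  have h4 : ∀ r ∈ Ioo (0 : ℝ) 1, ∫⁻ y, K y r = ENNReal.ofReal (r ^ Module.finrank ℝ A) * C := by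
    intro r hr
    rw [lintegral_eq_pow_mul_lintegral_smul _ hr.1, hC, ← lintegral_indicator measurableSet_ball]
    congr 1
    refine lintegral_congr fun u => ?_
    have hru : ‖r • u‖ = r * ‖u‖ := by rw [norm_smul, Real.norm_of_nonneg hr.1.le]
    have hs : √(r ^ 2 - ‖r • u‖ ^ 2) = r * √(1 - ‖u‖ ^ 2) := by
      rw [hru, show r ^ 2 - (r * ‖u‖) ^ 2 = r ^ 2 * (1 - ‖u‖ ^ 2) by ring,
        Real.sqrt_mul (sq_nonneg r), Real.sqrt_sq hr.1.le]
    by_cases hu : ‖u‖ < 1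
    · rw [indicator_of_mem (mem_ball_zero_iff.2 hu), hK]
      simp only
      rw [indicator_of_mem (show (r • u, r) ∈ {p : A × ℝ | ‖p.1‖ < p.2} by
        simp only [mem_ofPred_eq, hru]; nlinarith [hr.1])]
      simp only [hs]
      rw [div_mul_cancel_left₀ hr.1.ne', smul_add, map_smul, smul_smul, smul_smul, ← mul_assoc,
        inv_mul_cancel₀ hr.1.ne', one_smul, one_mul]
    · rw [indicator_of_notMem (by rwa [mem_ball_zero_iff]), hK]
      refine indicator_of_notMem ?_ _
      simp only [mem_ofPred_eq, hru]
      push Not at hu ⊢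
      nlinarith [hr.1]
  have h5 : ∫⁻ r in Ioo (0 : ℝ) 1, ENNReal.ofReal (r ^ Module.finrank ℝ A) =
      ((Module.finrank ℝ W : ENNReal))⁻¹ := by
    rw [← ofReal_integral_eq_lintegral_ofReal, ← integral_Ioc_eq_integral_Ioo,
      ← intervalIntegral.integral_of_le zero_le_one, integral_pow, ← hd]
    · simp only [one_pow, ne_eq, Nat.add_eq_zero_iff, one_ne_zero, and_false, not_false_eq_true,
        zero_pow, sub_zero, one_div]
      rw [ENNReal.ofReal_inv_of_pos (by positivity)]
      norm_cast
    · exact ((continuous_pow _).integrableOn_Icc (a := (0 : ℝ)) (b := 1)).mono_set Ioo_subset_Icc_self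
    · filter_upwards [ae_restrict_mem measurableSet_Ioo] with r hr
      exact pow_nonneg hr.1.le _
  have hmp := measurePreserving_orthogonal_add ι (LinearIsometry.toSpanSingleton ℝ W he)
    (fun a b => by rw [LinearIsometry.toSpanSingleton_apply, inner_smul_right, h, mul_zero])
    (by rw [Module.finrank_self, hd])
  simp only [LinearIsometry.toSpanSingleton_apply] at hmp
  have hGm' : Measurable fun p : A × ℝ => G (ι p.1 + p.2 • e) := hGm.comp hmp.measurable
  have h6 : ∫⁻ x, G x = ∫⁻ r in Ioo (0 : ℝ) 1, ∫⁻ y, K y r := by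
    rw [← hmp.lintegral_comp hGm, Measure.volume_eq_prod, lintegral_prod _ hGm'.aemeasurable]
    exact (lintegral_congr h2).trans (lintegral_lintegral_swap hKm.aemeasurable)
  rw [h1, h6, setLIntegral_congr_fun measurableSet_Ioo h4, lintegral_mul_const _ (by fun_prop), h5,
    ← mul_assoc, ENNReal.mul_inv_cancel, one_mul]
  · rw [← hd]; simp
  · simp

theorem integral_upper_hemisphere {V : Type*} [NormedAddCommGroup V] [NormedSpace ℝ V]
    (ι : A →ₗᵢ[ℝ] W) {e : W} (he : ‖e‖ = 1) (h : ∀ a, inner ℝ (ι a) e = 0)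
    (hd : Module.finrank ℝ A + 1 = Module.finrank ℝ W) {F : W → V} (hF : StronglyMeasurable F) :
    ∫ w in {w | 0 < inner ℝ w e}, F w ∂((surfaceMeasure W).map Subtype.val) =
      ∫ u in ball (0 : A) 1, (√(1 - ‖u‖ ^ 2))⁻¹ • F (ι u + √(1 - ‖u‖ ^ 2) • e) := by
  have hΨ : Measurable fun u : A => ι u + √(1 - ‖u‖ ^ 2) • e :=
    ι.continuous.measurable.add (by fun_prop)
  have hw : Measurable fun u : A => ENNReal.ofReal (√(1 - ‖u‖ ^ 2))⁻¹ := by fun_prop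
  have hμ : ((surfaceMeasure W).map Subtype.val).restrict {w | 0 < inner ℝ w e} =
      (((volume : Measure A).restrict (ball 0 1)).withDensity
        (fun u => ENNReal.ofReal (√(1 - ‖u‖ ^ 2))⁻¹)).map
        (fun u => ι u + √(1 - ‖u‖ ^ 2) • e) := by
    refine Measure.ext_of_lintegral _ fun g hg => ?_
    rw [lintegral_upper_hemisphere ι he h hd hg, lintegral_map hg hΨ]
    exact (lintegral_withDensity_eq_lintegral_mul _ hw (hg.comp hΨ)).symm
  rw [hμ, integral_map hΨ.aemeasurable hF.aestronglyMeasurable,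
    integral_withDensity_eq_integral_toReal_smul hw (by simp)]
  refine integral_congr_ae (.of_forall fun u => ?_)
  simp only
  rw [ENNReal.toReal_ofReal (by positivity)]

/-- The integral over the unit sphere of a function that vanishes on the equator `e^⊥` and is
even in the direction `e`, as an integral over the equatorial unit ball. -/
theorem integral_sphere_eq_of_even {V : Type*} [NormedAddCommGroup V] [NormedSpace ℝ V]
    (ι : A →ₗᵢ[ℝ] W) {e : W} (he : ‖e‖ = 1) (h : ∀ a, inner ℝ (ι a) e = 0)
    (hd : Module.finrank ℝ A + 1 = Module.finrank ℝ W) {F : W → V} (hF : StronglyMeasurable F)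
    {C : ℝ} (hC : ∀ w, ‖F w‖ ≤ C) (h0 : ∀ w, ‖w‖ = 1 → inner ℝ w e = 0 → F w = 0)
    (hev : ∀ (a : A) (s : ℝ), F (ι a - s • e) = F (ι a + s • e)) :
    ∫ w : sphere (0 : W) 1, F w ∂(surfaceMeasure W) =
      (2 : ℝ) • ∫ u in ball (0 : A) 1, (√(1 - ‖u‖ ^ 2))⁻¹ • F (ι u + √(1 - ‖u‖ ^ 2) • e) := by
  have : IsFiniteMeasure (surfaceMeasure W) := by unfold surfaceMeasure; infer_instance
  set μ := (surfaceMeasure W).map Subtype.val with hμ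
  have hmap : ∫ w : sphere (0 : W) 1, F w ∂(surfaceMeasure W) = ∫ w, F w ∂μ := by
    rw [hμ, integral_map measurable_subtype_coe.aemeasurable hF.aestronglyMeasurable]
  have hint : Integrable F μ := .of_bound hF.aestronglyMeasurable C (.of_forall hC)
  have hup : MeasurableSet {w : W | 0 < inner ℝ w e} :=
    measurableSet_lt measurable_const (by fun_prop)
  have hlo : MeasurableSet {w : W | 0 < inner ℝ w (-e)} :=
    measurableSet_lt measurable_const (by fun_prop)
  have hdisj : Disjoint {w : W | 0 < inner ℝ w e} {w : W | 0 < inner ℝ w (-e)} := by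
    rw [Set.disjoint_left]
    intro w (hw : 0 < inner ℝ w e) (hw' : 0 < inner ℝ w (-e))
    rw [inner_neg_right] at hw'
    linarith
  -- The equator drops out because F vanishes on it, so its measure need not be computed.
  have hsup : ∫ w, F w ∂μ = ∫ w in {w | 0 < inner ℝ w e} ∪ {w | 0 < inner ℝ w (-e)}, F w ∂μ := by
    refine (setIntegral_eq_integral_of_ae_compl_eq_zero ?_).symm
    rw [hμ, ae_map_iff measurable_subtype_coe.aemeasurable]
    · refine .of_forall fun w hw => h0 _ (norm_eq_of_mem_sphere w) ?_
      simp only [mem_union, mem_ofPred_eq, inner_neg_right, not_or, not_lt] at hw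
      linarith [hw.1, hw.2]
    · have : MeasurableSet {w | F w = 0} := hF.measurableSet_eq_fun stronglyMeasurable_const
      convert (hup.union hlo).union this using 1
      ext w
      simp only [mem_ofPred_eq, mem_union]
      tauto
  -- The lower hemisphere is the upper one for `-e`, and evenness identifies the two ball integrals.
  rw [hmap, hsup, setIntegral_union hdisj hlo hint.integrableOn hint.integrableOn,
    integral_upper_hemisphere ι he h hd hF,
    integral_upper_hemisphere ι (by rwa [norm_neg])
      (fun a => by rw [inner_neg_right, h, neg_zero]) hd hF, two_smul]
  congr 1
  refine integral_congr_ae (.of_forall fun u => ?_)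
  simp only
  rw [smul_neg, ← sub_eq_add_neg, hev]

end Hemisphere

/-! ### The slice transform as a Radon transform -/

section Slice

variable {n : ℕ}

/-- The vertical unit vector of `ℝ^{n+1}`. -/
noncomputable def verticalVector (n : ℕ) : EuclideanSpace ℝ (Fin (n + 1)) := EuclideanSpace.single (Fin.last n) 1

/-- `horizontalLift` as a linear isometry. -/
noncomputable def horizontalLiftIsometry (n : ℕ) :
    EuclideanSpace ℝ (Fin n) →ₗᵢ[ℝ] EuclideanSpace ℝ (Fin (n + 1)) where
  toFun := horizontalLift
  map_add' p q := by
    ext i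
    refine Fin.lastCases ?_ (fun j => ?_) i <;> simp [horizontalLift]
  map_smul' c p := by
    ext i
    refine Fin.lastCases ?_ (fun j => ?_) i <;> simp [horizontalLift]
  norm_map' p := by
    rw [EuclideanSpace.norm_eq, EuclideanSpace.norm_eq, Fin.sum_univ_castSucc]
    simp [horizontalLift]

theorem horizontalLiftIsometry_apply (p : EuclideanSpace ℝ (Fin n)) :
    horizontalLiftIsometry n p = horizontalLift p := rfl

theorem norm_verticalVector : ‖verticalVector n‖ = 1 := by simp [verticalVector]

theorem inner_horizontalLift_verticalVector (p : EuclideanSpace ℝ (Fin n)) :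
    inner ℝ (horizontalLift p) (verticalVector n) = 0 := by
  simp [verticalVector, horizontalLift, EuclideanSpace.inner_single_right]

theorem inner_verticalVector (x : EuclideanSpace ℝ (Fin (n + 1))) :
    inner ℝ x (verticalVector n) = x (Fin.last n) := by
  simp [verticalVector, EuclideanSpace.inner_single_right]

theorem norm_horizontalLift_add_sq (p : EuclideanSpace ℝ (Fin n)) (s : ℝ) :
    ‖horizontalLift p + s • verticalVector n‖ ^ 2 = ‖p‖ ^ 2 + s ^ 2 := by
  rw [norm_add_sq_real, inner_smul_right, inner_horizontalLift_verticalVector, norm_smul,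
    norm_verticalVector, ← horizontalLiftIsometry_apply, LinearIsometry.norm_map]
  simp

theorem horizontalPart_horizontalLift_add (p : EuclideanSpace ℝ (Fin n)) (s : ℝ) :
    horizontalPart (horizontalLift p + s • verticalVector n) = p := by
  ext i
  simp [horizontalPart, horizontalLift, verticalVector]

theorem horizontalLift_add_apply_last (p : EuclideanSpace ℝ (Fin n)) (s : ℝ) :
    (horizontalLift p + s • verticalVector n) (Fin.last n) = s := by
  simp [horizontalLift, verticalVector]

theorem horizontalLift_horizontalPart_add (x : EuclideanSpace ℝ (Fin (n + 1))) :
    horizontalLift (horizontalPart x) + x (Fin.last n) • verticalVector n = x := by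
  ext i
  refine Fin.lastCases ?_ (fun j => ?_) i <;>
    simp [horizontalPart, horizontalLift, verticalVector]

variable {𝕜 : Type*} [RCLike 𝕜]

/-- Extension by zero of a function on the sphere. -/
noncomputable def sphereExtend (f : sphere (0 : EuclideanSpace ℝ (Fin (n + 1))) 1 → 𝕜) :
    EuclideanSpace ℝ (Fin (n + 1)) → 𝕜 :=
  Function.extend Subtype.val f 0

/-- The density on `ℝ^n` obtained by projecting `f` times the surface measure of the upper
hemisphere: `f (p, √(1 - |p|²)) / √(1 - |p|²)` for `|p| < 1` and `0` for `|p| ≥ 1`. -/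
noncomputable def projectedDensity (f : sphere (0 : EuclideanSpace ℝ (Fin (n + 1))) 1 → 𝕜)
    (p : EuclideanSpace ℝ (Fin n)) : 𝕜 :=
  (√(1 - ‖p‖ ^ 2))⁻¹ • sphereExtend f (horizontalLift p + √(1 - ‖p‖ ^ 2) • verticalVector n)

variable {f : sphere (0 : EuclideanSpace ℝ (Fin (n + 1))) 1 → 𝕜}

theorem sphereExtend_coe (x : sphere (0 : EuclideanSpace ℝ (Fin (n + 1))) 1) :
    sphereExtend f x.1 = f x := Subtype.val_injective.extend_apply f
  (0 : EuclideanSpace ℝ (Fin (n + 1)) → 𝕜) x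

theorem sphereExtend_of_norm_ne {x : EuclideanSpace ℝ (Fin (n + 1))} (hx : ‖x‖ ≠ 1) :
    sphereExtend f x = 0 := by
  refine Function.extend_apply' f (0 : EuclideanSpace ℝ (Fin (n + 1)) → 𝕜) x ?_
  rintro ⟨y, rfl⟩
  exact hx (norm_eq_of_mem_sphere y)

theorem projectedDensity_of_one_le_norm {p : EuclideanSpace ℝ (Fin n)} (hp : 1 ≤ ‖p‖) :
    projectedDensity f p = 0 := by
  rw [projectedDensity, Real.sqrt_eq_zero_of_nonpos (by nlinarith), inv_zero, zero_smul]

theorem stronglyMeasurable_sphereExtend (hf : Continuous f) :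
    StronglyMeasurable (sphereExtend f) := by
  have he : MeasurableEmbedding
      (Subtype.val : ↥(sphere (0 : EuclideanSpace ℝ (Fin (n + 1))) 1) → EuclideanSpace ℝ (Fin (n + 1))) :=
    .subtype_coe isClosed_sphere.measurableSet
  exact he.stronglyMeasurable_extend hf.stronglyMeasurable stronglyMeasurable_const

theorem exists_norm_sphereExtend_le (hf : Continuous f) : ∃ C, ∀ x, ‖sphereExtend f x‖ ≤ C := by
  obtain ⟨C, hC⟩ := (isCompact_range hf).isBounded.exists_norm_le
  refine ⟨max C 0, fun x => ?_⟩
  by_cases hx : ‖x‖ = 1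
  · rw [sphereExtend_coe (f := f) ⟨x, mem_sphere_zero_iff_norm.2 hx⟩]
    exact (hC _ (mem_range_self _)).trans (le_max_left _ _)
  · rw [sphereExtend_of_norm_ne hx, norm_zero]
    exact le_max_right _ _

theorem IsSmoothEvenVanishing.sphereExtend_even (hf : IsSmoothEvenVanishing f)
    (p : EuclideanSpace ℝ (Fin n)) (s : ℝ) :
    sphereExtend f (horizontalLift p - s • verticalVector n) =
      sphereExtend f (horizontalLift p + s • verticalVector n) := by
  rw [sub_eq_add_neg, ← neg_smul]
  by_cases h : ‖p‖ ^ 2 + s ^ 2 = 1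
  · have h1 : ‖horizontalLift p + s • verticalVector n‖ = 1 := by
      rw [← sq_eq_sq₀ (norm_nonneg _) zero_le_one, norm_horizontalLift_add_sq, h, one_pow]
    have h2 : ‖horizontalLift p + (-s) • verticalVector n‖ = 1 := by
      rw [← sq_eq_sq₀ (norm_nonneg _) zero_le_one, norm_horizontalLift_add_sq, neg_sq, h, one_pow]
    have := hf.even ⟨_, mem_sphere_zero_iff_norm.2 h2⟩ ⟨_, mem_sphere_zero_iff_norm.2 h1⟩
      (by rw [horizontalPart_horizontalLift_add, horizontalPart_horizontalLift_add])
      (by rw [horizontalLift_add_apply_last, horizontalLift_add_apply_last])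
    rw [← sphereExtend_coe (f := f), ← sphereExtend_coe (f := f)] at this
    exact this
  · rw [sphereExtend_of_norm_ne, sphereExtend_of_norm_ne]
    · intro h1
      exact h (by rw [← norm_horizontalLift_add_sq, h1, one_pow])
    · intro h1
      exact h (by rw [← neg_sq s, ← norm_horizontalLift_add_sq, h1, one_pow])

theorem IsSmoothEvenVanishing.sphereExtend_equator (hf : IsSmoothEvenVanishing f)
    {x : EuclideanSpace ℝ (Fin (n + 1))} (hx : x (Fin.last n) = 0) : sphereExtend f x = 0 := by
  obtain ⟨U, -, hU, hUf⟩ := hf.vanishing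
  by_cases h : ‖x‖ = 1
  · rw [sphereExtend_coe (f := f) ⟨x, mem_sphere_zero_iff_norm.2 h⟩]
    exact hUf _ (hU hx)
  · exact sphereExtend_of_norm_ne h

/-- Extending f by zero moves the integral from the subtype to the ambient space, where the
pushforward defining the slice measure can be unfolded. -/
theorem verticalSlice_eq_integral_sphereExtend (hf : Continuous f)
    (θ : sphere (0 : EuclideanSpace ℝ (Fin n)) 1) (t : ℝ) :
    verticalSlice f θ t = (√(1 - t ^ 2) ^ (n - 1)) •
      ∫ w : sphere (0 : (ℝ ∙ horizontalLift θ.1)ᗮ) 1,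
        sphereExtend f (t • horizontalLift θ.1 + √(1 - t ^ 2) • (w.1 : EuclideanSpace ℝ _))
        ∂(surfaceMeasure (ℝ ∙ horizontalLift θ.1)ᗮ) := by
  have hm := stronglyMeasurable_sphereExtend hf
  have hΦ : Continuous fun w : sphere (0 : (ℝ ∙ horizontalLift θ.1)ᗮ) 1 =>
      t • horizontalLift θ.1 +
        √(1 - t ^ 2) • ((w : (ℝ ∙ horizontalLift θ.1)ᗮ) : EuclideanSpace ℝ (Fin (n + 1))) := by
    fun_prop
  have h1 : verticalSlice f θ t = ∫ x, sphereExtend f x.1 ∂(sliceMeasure θ t) := by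
    simp only [sphereExtend_coe]; rfl
  rw [h1, sliceMeasure, integral_subtype_comap isClosed_sphere.measurableSet (sphereExtend f),
    setIntegral_eq_integral_of_forall_compl_eq_zero, integral_smul_measure,
    integral_map hΦ.measurable.aemeasurable hm.aestronglyMeasurable,
    ENNReal.toReal_ofReal (by positivity)]
  intro x hx
  exact sphereExtend_of_norm_ne (by rwa [mem_sphere_zero_iff_norm] at hx)

theorem norm_smul_add_orthogonal_sq (θ : sphere (0 : EuclideanSpace ℝ (Fin n)) 1) (t : ℝ)
    (y : (ℝ ∙ θ.1)ᗮ) : ‖t • θ.1 + (y : EuclideanSpace ℝ (Fin n))‖ ^ 2 = t ^ 2 + ‖y‖ ^ 2 := by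
  have : inner ℝ θ.1 (y : EuclideanSpace ℝ (Fin n)) = 0 :=
    Submodule.mem_orthogonal_singleton_iff_inner_right.1 y.2
  rw [norm_add_sq_real, real_inner_smul_left, this, norm_smul, norm_eq_of_mem_sphere]
  simp

theorem finrank_orthogonal_add_one {V : Type*} [NormedAddCommGroup V] [InnerProductSpace ℝ V]
    [FiniteDimensional ℝ V] {v : V} (hv : v ≠ 0) :
    Module.finrank ℝ (ℝ ∙ v)ᗮ + 1 = Module.finrank ℝ V := by
  rw [← Submodule.finrank_add_finrank_orthogonal (ℝ ∙ v), finrank_span_singleton hv, add_comm]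

/-- The weighted vertical slice transform is twice the Radon transform of the projected density. -/
theorem IsSmoothEvenVanishing.weighted_verticalSlice_eq (hf : IsSmoothEvenVanishing f)
    (θ : sphere (0 : EuclideanSpace ℝ (Fin n)) 1) (t : ℝ) :
    weighted (verticalSlice f) θ t =
      (2 : ℝ) • ∫ y : (ℝ ∙ θ.1)ᗮ, projectedDensity f (t • θ.1 + y) := by
  have hcont : Continuous f := hf.smooth.continuous
  -- For t² ≥ 1 both sides are zero: the real square root and its inverse are zero there, and the
  -- hyperplane misses the open unit ball.
  by_cases ht : t ^ 2 < 1
  swap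
  · rw [weighted, Real.sqrt_eq_zero_of_nonpos (by linarith), inv_zero, zero_smul]
    have (y : (ℝ ∙ θ.1)ᗮ) : projectedDensity f (t • θ.1 + y) = 0 := by
      refine projectedDensity_of_one_le_norm ?_
      rw [← one_le_sq_iff₀ (norm_nonneg _), norm_smul_add_orthogonal_sq]
      nlinarith
    simp [this]
  set ρ := √(1 - t ^ 2) with hρ
  have hρ0 : 0 < ρ := Real.sqrt_pos.2 (by linarith)
  have hρ2 : ρ ^ 2 = 1 - t ^ 2 := Real.sq_sqrt (by linarith)
  have hθ0 : θ.1 ≠ 0 := ne_zero_of_mem_unit_sphere θ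
  have hL0 : horizontalLift θ.1 ≠ 0 := by
    rw [← horizontalLiftIsometry_apply]
    exact (map_ne_zero_iff _ (horizontalLiftIsometry n).injective).2 hθ0
  have he : verticalVector n ∈ (ℝ ∙ horizontalLift θ.1)ᗮ :=
    Submodule.mem_orthogonal_singleton_iff_inner_right.2 (inner_horizontalLift_verticalVector _)
  -- The hyperplane θ^⊥ of ℝ^n is the equatorial hyperplane of the slice direction space, whose pole
  -- is the vertical vector.
  let ι : (ℝ ∙ θ.1)ᗮ →ₗᵢ[ℝ] (ℝ ∙ horizontalLift θ.1)ᗮ :=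
    { toLinearMap := ((horizontalLiftIsometry n).toLinearMap ∘ₗ
        (ℝ ∙ θ.1)ᗮ.subtype).codRestrict _ fun y => by
          refine Submodule.mem_orthogonal_singleton_iff_inner_right.2 ?_
          rw [← horizontalLiftIsometry_apply]
          exact ((horizontalLiftIsometry n).inner_map_map _ _).trans
            (Submodule.mem_orthogonal_singleton_iff_inner_right.1 y.2)
      norm_map' := fun y => (horizontalLiftIsometry n).norm_map y }
  have hι (y : (ℝ ∙ θ.1)ᗮ) : (ι y : EuclideanSpace ℝ (Fin (n + 1))) = horizontalLift y.1 := rfl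
  set F : (ℝ ∙ horizontalLift θ.1)ᗮ → 𝕜 := fun w =>
    sphereExtend f (t • horizontalLift θ.1 + ρ • (w : EuclideanSpace ℝ (Fin (n + 1)))) with hF
  have hFι (u : (ℝ ∙ θ.1)ᗮ) (s : ℝ) : F (ι u + s • ⟨verticalVector n, he⟩) = sphereExtend f
      (horizontalLift (t • θ.1 + ρ • (u : EuclideanSpace ℝ (Fin n))) +
        (ρ * s) • verticalVector n) := by
    change sphereExtend f (t • horizontalLift θ.1 +
      ρ • (horizontalLift u.1 + s • verticalVector n)) = _
    simp only [← horizontalLiftIsometry_apply, map_add, map_smul, smul_add, smul_smul, add_assoc]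
  have hFm : StronglyMeasurable F :=
    (stronglyMeasurable_sphereExtend hcont).comp_measurable (by fun_prop)
  obtain ⟨C, hC⟩ := exists_norm_sphereExtend_le hcont
  have hint := integral_sphere_eq_of_even ι (e := ⟨verticalVector n, he⟩) norm_verticalVector
    (fun a => inner_horizontalLift_verticalVector _)
    (by
      have h1 := finrank_orthogonal_add_one hθ0
      have h2 := finrank_orthogonal_add_one hL0
      rw [finrank_euclideanSpace_fin] at h1 h2
      rw [h1]
      omega) hFm (fun w => hC _)
    (fun w _ hw => hf.sphereExtend_equator (by
      have hw' : inner ℝ (w : EuclideanSpace ℝ (Fin (n + 1))) (verticalVector n) = 0 := hw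
      rw [← inner_verticalVector, inner_add_left, inner_smul_left, inner_smul_left, hw',
        inner_horizontalLift_verticalVector, mul_zero, mul_zero, add_zero]))
    (fun a s => by
      rw [hFι, sub_eq_add_neg, ← neg_smul, hFι, mul_neg, neg_smul, ← sub_eq_add_neg,
        hf.sphereExtend_even])
  have hball : ∫ u in ball (0 : (ℝ ∙ θ.1)ᗮ) 1, (√(1 - ‖u‖ ^ 2))⁻¹ •
      F (ι u + √(1 - ‖u‖ ^ 2) • ⟨verticalVector n, he⟩) =
      ρ • ∫ u : (ℝ ∙ θ.1)ᗮ, projectedDensity f (t • θ.1 + ρ • (u : EuclideanSpace ℝ (Fin n))) := by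
    -- By this identity the hemisphere weight at u is exactly ρ times the weight built into the
    -- density.
    have hn (u : (ℝ ∙ θ.1)ᗮ) : 1 - ‖t • θ.1 + ρ • (u : EuclideanSpace ℝ (Fin n))‖ ^ 2 =
        ρ ^ 2 * (1 - ‖u‖ ^ 2) := by
      have := norm_smul_add_orthogonal_sq θ t (ρ • u)
      rw [Submodule.coe_smul, norm_smul, Real.norm_of_nonneg hρ0.le] at this
      rw [this]
      linear_combination (-1 : ℝ) * hρ2
    rw [← integral_smul, ← integral_indicator measurableSet_ball]
    refine integral_congr_ae (.of_forall fun u => ?_)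
    simp only
    by_cases hu : ‖u‖ < 1
    · rw [indicator_of_mem (mem_ball_zero_iff.2 hu), hFι, projectedDensity, hn,
        Real.sqrt_mul (sq_nonneg ρ), Real.sqrt_sq hρ0.le, smul_smul, mul_inv,
        mul_inv_cancel_left₀ hρ0.ne']
    · rw [indicator_of_notMem (by rwa [mem_ball_zero_iff]), projectedDensity_of_one_le_norm,
        smul_zero]
      rw [← one_le_sq_iff₀ (norm_nonneg _)]
      push Not at hu
      nlinarith [hn u, one_le_pow₀ hu (n := 2)]
  have hscale : ∫ u : (ℝ ∙ θ.1)ᗮ, projectedDensity f (t • θ.1 + ρ • (u : EuclideanSpace ℝ (Fin n)))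
      = (ρ ^ (n - 1))⁻¹ • ∫ y : (ℝ ∙ θ.1)ᗮ, projectedDensity f (t • θ.1 + y) := by
    have h1 := Measure.integral_comp_smul (volume : Measure (ℝ ∙ θ.1)ᗮ)
      (fun y => projectedDensity f (t • θ.1 + (y : EuclideanSpace ℝ (Fin n)))) ρ
    have h2 := finrank_orthogonal_add_one hθ0
    rw [finrank_euclideanSpace_fin] at h2
    rw [abs_of_pos (by positivity), eq_tsub_of_add_eq h2] at h1
    exact h1
  -- The powers of ρ cancel: ρ⁻¹ from the weight, ρ^{n-1} from the slice measure, ρ from the ball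
  -- integral, ρ^{-(n-1)} from rescaling.
  rw [weighted, verticalSlice_eq_integral_sphereExtend hcont, ← hρ, hint, hball, hscale]
  simp only [smul_smul]
  congr 1
  field_simp

end Slice

/-! ### Smoothness and support of the projected density -/

section Smooth

variable {n : ℕ} {𝕜 : Type*} [RCLike 𝕜]
  {f : sphere (0 : EuclideanSpace ℝ (Fin (n + 1))) 1 → 𝕜}

theorem norm_gnomonic (p : EuclideanSpace ℝ (Fin n)) :
    ‖(√(1 + ‖p‖ ^ 2))⁻¹ • (horizontalLift p + (1 : ℝ) • verticalVector n)‖ = 1 := by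
  have h1 : ‖horizontalLift p + (1 : ℝ) • verticalVector n‖ = √(1 + ‖p‖ ^ 2) := by
    rw [← Real.sqrt_sq (norm_nonneg (horizontalLift p + _)), norm_horizontalLift_add_sq, one_pow,
      add_comm]
  rw [norm_smul, norm_inv, h1, Real.norm_of_nonneg (by positivity),
    inv_mul_cancel₀ (by positivity)]

/-- The central projection of the horizontal hyperplane at height one to the sphere. -/
noncomputable def gnomonic (p : EuclideanSpace ℝ (Fin n)) :
    sphere (0 : EuclideanSpace ℝ (Fin (n + 1))) 1 :=
  ⟨(√(1 + ‖p‖ ^ 2))⁻¹ • (horizontalLift p + (1 : ℝ) • verticalVector n),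
    mem_sphere_zero_iff_norm.2 (norm_gnomonic p)⟩

theorem contMDiff_gnomonic :
    ContMDiff (𝓡 n) (𝓡 n) ∞ (gnomonic : EuclideanSpace ℝ (Fin n) → _) := by
  have h : ContDiff ℝ ∞ fun p : EuclideanSpace ℝ (Fin n) =>
      (√(1 + ‖p‖ ^ 2))⁻¹ • (horizontalLift p + (1 : ℝ) • verticalVector n) := by
    have hL : ContDiff ℝ ∞ (horizontalLift : EuclideanSpace ℝ (Fin n) → _) :=
      (horizontalLiftIsometry n).toContinuousLinearMap.contDiff
    have hn : ContDiff ℝ ∞ fun p : EuclideanSpace ℝ (Fin n) => 1 + ‖p‖ ^ 2 :=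
      contDiff_const.add (contDiff_norm_sq ℝ)
    exact ((hn.sqrt fun p => by positivity).inv fun p => by positivity).smul
      (hL.add contDiff_const)
  exact h.contMDiff.codRestrict_sphere _

/-- The complement of the neighborhood of the equator is compact, so |x_{n+1}| has a positive lower
bound m on it, and r = √(1 - m²) works. -/
theorem IsSmoothEvenVanishing.exists_projectedDensity_eq_zero (hf : IsSmoothEvenVanishing f) :
    ∃ r < 1, ∀ p, r < ‖p‖ → projectedDensity f p = 0 := by
  obtain ⟨U, hUo, hU, hUf⟩ := hf.vanishing
  obtain ⟨m, hm, hmU⟩ : ∃ m : ℝ, 0 < m ∧ ∀ x ∉ U, m ≤ |x.1 (Fin.last n)| := by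
    obtain h | h := (Uᶜ).eq_empty_or_nonempty
    · refine ⟨1, one_pos, fun x hx => ?_⟩
      exact absurd (show x ∈ Uᶜ from hx) (h ▸ notMem_empty x)
    · have hc : ContinuousOn (fun x : sphere (0 : EuclideanSpace ℝ (Fin (n + 1))) 1 =>
          |x.1 (Fin.last n)|) Uᶜ := by fun_prop
      obtain ⟨x, hx, hmin⟩ := hUo.isClosed_compl.isCompact.exists_isMinOn h hc
      exact ⟨_, abs_pos.2 fun h0 => hx (hU h0), fun y hy => hmin hy⟩
  refine ⟨√(1 - m ^ 2), by rw [Real.sqrt_lt' one_pos]; nlinarith, fun p hp => ?_⟩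
  obtain hp1 | hp1 := le_or_gt 1 ‖p‖
  · exact projectedDensity_of_one_le_norm hp1
  have hp2 : 1 - m ^ 2 < ‖p‖ ^ 2 := Real.lt_sq_of_sqrt_lt hp
  have hnn : 0 ≤ 1 - ‖p‖ ^ 2 := by nlinarith [norm_nonneg p]
  have hnorm : ‖horizontalLift p + √(1 - ‖p‖ ^ 2) • verticalVector n‖ = 1 := by
    rw [← sq_eq_sq₀ (norm_nonneg _) zero_le_one, norm_horizontalLift_add_sq, Real.sq_sqrt hnn]
    ring
  rw [projectedDensity, sphereExtend_coe (f := f) ⟨_, mem_sphere_zero_iff_norm.2 hnorm⟩,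
    hUf, smul_zero]
  by_contra hx
  have := hmU _ hx
  simp only [horizontalLift_add_apply_last] at this
  rw [abs_of_nonneg (Real.sqrt_nonneg _), Real.le_sqrt hm.le hnn] at this
  linarith

/-- Inside the open ball the point above p is `gnomonic` of p / √(1-|p|²), and `gnomonic` is smooth
on all of ℝ^n; so f enters only through a smooth function on a vector space. Beyond radius r the
density is locally zero. -/
theorem IsSmoothEvenVanishing.contDiff_projectedDensity (hf : IsSmoothEvenVanishing f) :
    ContDiff ℝ ∞ (projectedDensity f) := by
  obtain ⟨r, hr, hr0⟩ := hf.exists_projectedDensity_eq_zero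
  refine contDiff_iff_contDiffAt.2 fun p => ?_
  obtain hp | hp := lt_or_ge r ‖p‖
  · have : projectedDensity f =ᶠ[nhds p] fun _ => 0 := by
      filter_upwards [(isOpen_lt continuous_const continuous_norm).mem_nhds hp] with q hq
      exact hr0 q hq
    exact contDiffAt_const.congr_of_eventuallyEq this
  · have hp1 : ‖p‖ < 1 := hp.trans_lt hr
    have hg : ContDiff ℝ ∞ (f ∘ gnomonic) := (hf.smooth.comp contMDiff_gnomonic).contDiff
    have hq : ContDiffAt ℝ ∞ (fun q : EuclideanSpace ℝ (Fin n) => (√(1 - ‖q‖ ^ 2))⁻¹) p := by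
      have h0 : 0 < 1 - ‖p‖ ^ 2 := by nlinarith [norm_nonneg p]
      refine ContDiffAt.inv (ContDiffAt.sqrt ?_ h0.ne') (Real.sqrt_pos.2 h0).ne'
      exact contDiffAt_const.sub (contDiff_norm_sq ℝ).contDiffAt
    have hcomp : ContDiffAt ℝ ∞ (fun q : EuclideanSpace ℝ (Fin n) =>
        (√(1 - ‖q‖ ^ 2))⁻¹ • (f ∘ gnomonic) ((√(1 - ‖q‖ ^ 2))⁻¹ • q)) p :=
      hq.smul (hg.contDiffAt.comp p (hq.smul contDiffAt_id))
    refine hcomp.congr_of_eventuallyEq ?_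
    filter_upwards [(isOpen_lt continuous_norm continuous_const).mem_nhds hp1] with q hq1
    have h0 : 0 < 1 - ‖q‖ ^ 2 := by
      have : ‖q‖ < 1 := hq1
      nlinarith [norm_nonneg q]
    have hs := Real.sqrt_pos.2 h0
    rw [projectedDensity, Function.comp_apply, ← sphereExtend_coe (f := f)]
    congr 2
    have h1 : √(1 + ‖(√(1 - ‖q‖ ^ 2))⁻¹ • q‖ ^ 2) = (√(1 - ‖q‖ ^ 2))⁻¹ := by
      rw [norm_smul, Real.norm_of_nonneg (by positivity), mul_pow, inv_pow, Real.sq_sqrt h0.le,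
        ← Real.sqrt_inv]
      congr 1
      field_simp
      ring
    simp only [gnomonic, h1, inv_inv, ← horizontalLiftIsometry_apply, map_smul, smul_add, smul_smul,
      mul_inv_cancel₀ hs.ne', one_smul]

theorem hasCompactSupport_projectedDensity : HasCompactSupport (projectedDensity f) := by
  refine HasCompactSupport.intro (isCompact_closedBall 0 1) fun p hp => ?_
  refine projectedDensity_of_one_le_norm ?_
  rw [mem_closedBall_zero_iff, not_le] at hp
  exact hp.le

/-- On the sphere √(1-|x'|²) = |x_{n+1}|, which undoes the weight off the equator; the lower
hemisphere follows by evenness, and on the equator both sides vanish. -/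
theorem IsSmoothEvenVanishing.apply_eq_projectedDensity (hf : IsSmoothEvenVanishing f)
    (x : sphere (0 : EuclideanSpace ℝ (Fin (n + 1))) 1) :
    f x = |x.1 (Fin.last n)| • projectedDensity f (horizontalPart x.1) := by
  have hx : ‖horizontalPart x.1‖ ^ 2 + x.1 (Fin.last n) ^ 2 = 1 := by
    rw [← norm_horizontalLift_add_sq, horizontalLift_horizontalPart_add, norm_eq_of_mem_sphere,
      one_pow]
  have hs : √(1 - ‖horizontalPart x.1‖ ^ 2) = |x.1 (Fin.last n)| := by
    rw [← Real.sqrt_sq_eq_abs]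
    congr 1
    linarith
  rw [projectedDensity, hs, ← sphereExtend_coe (f := f)]
  by_cases h0 : x.1 (Fin.last n) = 0
  · rw [hf.sphereExtend_equator h0, h0, abs_zero, zero_smul]
  rw [smul_smul, mul_inv_cancel₀ (abs_ne_zero.2 h0), one_smul]
  obtain h | h := abs_choice (x.1 (Fin.last n))
  · rw [h, horizontalLift_horizontalPart_add]
  · rw [h, neg_smul, ← sub_eq_add_neg, hf.sphereExtend_even, horizontalLift_horizontalPart_add]

end Smooth

open FourierTransform Filter

/-! ### The Fourier transform of the logarithm -/

section LogKernel

/-- The odd function `sgn(r) e^{-ε|r|}`. -/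
noncomputable def signExp (ε r : ℝ) : ℂ :=
  (Ioi (0 : ℝ)).indicator (fun r : ℝ => Complex.exp (-ε * r)) r -
    (Iic (0 : ℝ)).indicator (fun r : ℝ => Complex.exp (ε * r)) r

theorem integrable_signExp {ε : ℝ} (hε : 0 < ε) : Integrable (signExp ε) := by
  refine Integrable.sub ?_ ?_
  · rw [integrable_indicator_iff measurableSet_Ioi]
    exact integrableOn_exp_mul_complex_Ioi (by simpa using hε) 0
  · rw [integrable_indicator_iff measurableSet_Iic]
    exact integrableOn_exp_mul_complex_Iic (by simpa using hε) 0

theorem signExp_mul_self (ε r : ℝ) : signExp ε r * r = (|r| * Real.exp (-ε * |r|) : ℝ) := by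
  rw [signExp]
  obtain hr | hr := lt_or_ge 0 r
  · rw [indicator_of_mem (show r ∈ Ioi 0 from hr), indicator_of_notMem (by simpa using hr),
      abs_of_pos hr]
    push_cast
    ring
  · rw [indicator_of_notMem (by simpa using hr), indicator_of_mem (show r ∈ Iic 0 from hr),
      abs_of_nonpos hr]
    push_cast
    ring_nf

/-- The right side is -i/π times the derivative of `smoothLog`: a regularization of the pairing
between sgn and the principal value of 1/t. -/
theorem fourier_signExp {ε : ℝ} (hε : 0 < ε) (t : ℝ) :
    𝓕 (signExp ε) t =
      -(Complex.I / Real.pi) * ((4 * Real.pi ^ 2 * t / (ε ^ 2 + 4 * Real.pi ^ 2 * t ^ 2) : ℝ) : ℂ) := by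
  set a : ℂ := -ε - 2 * Real.pi * t * Complex.I with ha
  set b : ℂ := ε - 2 * Real.pi * t * Complex.I with hb
  have har : a.re < 0 := by simpa [ha] using hε
  have hbr : 0 < b.re := by simpa [hb] using hε
  have h1 : ∀ v : ℝ, Complex.exp (↑(-2 * Real.pi * v * t) * Complex.I) • signExp ε v =
      (Ioi (0 : ℝ)).indicator (fun r : ℝ => Complex.exp (a * r)) v -
        (Iic (0 : ℝ)).indicator (fun r : ℝ => Complex.exp (b * r)) v := by
    intro v
    obtain hv | hv := lt_or_ge 0 v
    · have h1 : v ∈ Ioi (0 : ℝ) := hv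
      have h2 : v ∉ Iic (0 : ℝ) := by simpa using hv
      rw [signExp]
      simp only [indicator_of_mem h1, indicator_of_notMem h2, sub_zero, smul_eq_mul]
      rw [← Complex.exp_add, ha]
      congr 1
      push_cast
      ring
    · have h1 : v ∉ Ioi (0 : ℝ) := by simpa using hv
      have h2 : v ∈ Iic (0 : ℝ) := hv
      rw [signExp]
      simp only [indicator_of_notMem h1, indicator_of_mem h2, zero_sub, smul_eq_mul, mul_neg]
      rw [← Complex.exp_add, hb]
      congr 2
      push_cast
      ring
  rw [Real.fourier_real_eq_integral_exp_smul]
  simp_rw [h1]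
  rw [integral_sub, integral_indicator measurableSet_Ioi, integral_indicator measurableSet_Iic,
    integral_exp_mul_complex_Ioi har, integral_exp_mul_complex_Iic hbr]
  · have ha0 : a ≠ 0 := by rintro h; simp [h] at har
    have hb0 : b ≠ 0 := by rintro h; simp [h] at hbr
    have hab : a * b = -((ε ^ 2 + 4 * Real.pi ^ 2 * t ^ 2 : ℝ) : ℂ) := by
      rw [ha, hb]
      push_cast
      linear_combination (4 * Real.pi ^ 2 * t ^ 2 : ℂ) * Complex.I_sq
    have hd : ((ε ^ 2 + 4 * Real.pi ^ 2 * t ^ 2 : ℝ) : ℂ) ≠ 0 := by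
      rw [← neg_ne_zero, ← hab]
      exact mul_ne_zero ha0 hb0
    have hsum : a + b = -(4 * Real.pi * t * Complex.I) := by rw [ha, hb]; ring
    have hπ : (Real.pi : ℂ) ≠ 0 := by exact_mod_cast Real.pi_ne_zero
    have h2 : -Complex.exp (a * (0 : ℝ)) / a - Complex.exp (b * (0 : ℝ)) / b = -(a + b) / (a * b) := by
      simp only [Complex.ofReal_zero, mul_zero, Complex.exp_zero]
      field_simp
      ring
    rw [h2, hab, hsum, Complex.ofReal_div]
    field_simp
    push_cast
    ring
  · rw [integrable_indicator_iff measurableSet_Ioi]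
    exact integrableOn_exp_mul_complex_Ioi har 0
  · rw [integrable_indicator_iff measurableSet_Iic]
    exact integrableOn_exp_mul_complex_Iic hbr 0

/-- Smoothing of `log |2πt|`. -/
noncomputable def smoothLog (ε t : ℝ) : ℝ := Real.log (ε ^ 2 + 4 * Real.pi ^ 2 * t ^ 2) / 2

theorem hasDerivAt_smoothLog {ε : ℝ} (hε : 0 < ε) (t : ℝ) :
    HasDerivAt (smoothLog ε) (4 * Real.pi ^ 2 * t / (ε ^ 2 + 4 * Real.pi ^ 2 * t ^ 2)) t := by
  have h1 : HasDerivAt (fun t : ℝ => ε ^ 2 + 4 * Real.pi ^ 2 * t ^ 2)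
      (4 * Real.pi ^ 2 * (2 * t)) t := by
    simpa using ((hasDerivAt_pow 2 t).const_mul (4 * Real.pi ^ 2)).const_add (ε ^ 2)
  have h2 := (h1.log (by positivity)).div_const 2
  have h3 : 4 * Real.pi ^ 2 * (2 * t) / (ε ^ 2 + 4 * Real.pi ^ 2 * t ^ 2) / 2 =
      4 * Real.pi ^ 2 * t / (ε ^ 2 + 4 * Real.pi ^ 2 * t ^ 2) := by
    ring
  rw [h3] at h2
  exact h2

/-- Move the Fourier transform from `signExp` to H'. There it yields 2πir Ĥ(r), and r times the
regularized sign is |r| e^{-ε|r|}. On the other side, integrate by parts to pass from the derivative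
of `smoothLog` to `smoothLog` itself. -/
theorem integral_abs_mul_exp_mul_fourier {H : ℝ → ℂ} (hH : ContDiff ℝ ∞ H)
    (hc : HasCompactSupport H) {ε : ℝ} (hε : 0 < ε) :
    (2 * Real.pi ^ 2 : ℂ) * ∫ r : ℝ, ((|r| * Real.exp (-ε * |r|) : ℝ) : ℂ) * 𝓕 H r =
      ∫ t, (smoothLog ε t : ℂ) * deriv (deriv H) t := by
  have hH1 : ContDiff ℝ ∞ (deriv H) := ContDiff.deriv' hH
  have hH2 : ContDiff ℝ ∞ (deriv (deriv H)) := ContDiff.deriv' hH1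
  have hc1 : HasCompactSupport (deriv H) := hc.deriv
  have hc2 : HasCompactSupport (deriv (deriv H)) := hc1.deriv
  have hiH1 : Integrable (deriv H) := hH1.continuous.integrable_of_hasCompactSupport hc1
  have hflip : ∫ t, 𝓕 (signExp ε) t • deriv H t = ∫ r, signExp ε r • 𝓕 (deriv H) r := by
    simpa using! VectorFourier.integral_fourierIntegral_smul_eq_flip (L := innerₗ ℝ)
      Real.continuous_fourierChar continuous_inner (integrable_signExp hε) hiH1
  rw [Real.fourier_deriv (hH.continuous.integrable_of_hasCompactSupport hc)
    (hH.differentiable (by simp)) hiH1] at hflip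
  have hL : ∀ t, HasDerivAt (fun t => (smoothLog ε t : ℂ))
      ((4 * Real.pi ^ 2 * t / (ε ^ 2 + 4 * Real.pi ^ 2 * t ^ 2) : ℝ) : ℂ) t :=
    fun t => (hasDerivAt_smoothLog hε t).ofReal_comp
  have hLc : Continuous fun t => (smoothLog ε t : ℂ) :=
    continuous_iff_continuousAt.2 fun t => (hL t).continuousAt
  have hL'c : Continuous fun t : ℝ =>
      ((4 * Real.pi ^ 2 * t / (ε ^ 2 + 4 * Real.pi ^ 2 * t ^ 2) : ℝ) : ℂ) := by
    refine Complex.continuous_ofReal.comp (Continuous.div (by fun_prop) (by fun_prop) fun t => ?_)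
    positivity
  have hparts := integral_mul_deriv_eq_deriv_mul_of_integrable (fun t _ => hL t)
    (v := deriv H) (v' := deriv (deriv H))
    (fun t _ => (hH1.differentiable (by simp) t).hasDerivAt)
    ((hLc.mul hH2.continuous).integrable_of_hasCompactSupport hc2.mul_left)
    ((hL'c.mul hH1.continuous).integrable_of_hasCompactSupport hc1.mul_left)
    ((hLc.mul hH1.continuous).integrable_of_hasCompactSupport hc1.mul_left)
  have h1 : ∫ t, 𝓕 (signExp ε) t • deriv H t = -(Complex.I / Real.pi) *
      ∫ t, ((4 * Real.pi ^ 2 * t / (ε ^ 2 + 4 * Real.pi ^ 2 * t ^ 2) : ℝ) : ℂ) * deriv H t := by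
    rw [← integral_const_mul]
    refine integral_congr_ae (.of_forall fun t => ?_)
    simp only [fourier_signExp hε, smul_eq_mul, mul_assoc]
  have h2 : ∫ r : ℝ, signExp ε r • ((2 * Real.pi * Complex.I * r) • 𝓕 H r) =
      (2 * Real.pi * Complex.I) *
        ∫ r : ℝ, ((|r| * Real.exp (-ε * |r|) : ℝ) : ℂ) * 𝓕 H r := by
    rw [← integral_const_mul]
    refine integral_congr_ae (.of_forall fun r => ?_)
    simp only [smul_eq_mul, ← signExp_mul_self]
    ring
  rw [h1] at hflip
  rw [hparts]
  have hπ : (Real.pi : ℂ) ≠ 0 := by exact_mod_cast Real.pi_ne_zero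
  have h3 := hflip.trans h2
  set X := ∫ r : ℝ, ((|r| * Real.exp (-ε * |r|) : ℝ) : ℂ) * 𝓕 H r
  set Y := ∫ t, ((4 * Real.pi ^ 2 * t / (ε ^ 2 + 4 * Real.pi ^ 2 * t ^ 2) : ℝ) : ℂ) * deriv H t
  have h4 : -Complex.I * Y = Complex.I * (2 * Real.pi ^ 2 * X) := by
    calc -Complex.I * Y = Real.pi * (-(Complex.I / Real.pi) * Y) := by field_simp
      _ = Complex.I * (2 * Real.pi ^ 2 * X) := by rw [h3]; ring
  refine mul_left_cancel₀ Complex.I_ne_zero ?_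
  rw [← h4]
  ring

theorem locallyIntegrable_log : LocallyIntegrable Real.log := by
  intro x
  refine ⟨Ioc (x - 1) (x + 1), Ioc_mem_nhds (by linarith) (by linarith), ?_⟩
  exact (intervalIntegral.intervalIntegrable_log' (a := x - 1) (b := x + 1)).1

theorem integrable_log_mul {G : ℝ → ℂ} (hG : Continuous G) (hc : HasCompactSupport G) :
    Integrable fun t : ℝ => (Real.log t : ℂ) * G t := by
  simpa only [Complex.real_smul] using!
    locallyIntegrable_log.integrable_smul_right_of_hasCompactSupport hG hc

/-- A bound uniform in ε for dominated convergence: by monotonicity in ε, the value lies between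
log|2πt| and the value at ε = 1. -/
theorem abs_smoothLog_le {ε : ℝ} (hε : 0 < ε) (hε1 : ε ≤ 1) {t : ℝ} (ht : t ≠ 0) :
    |smoothLog ε t| ≤
      |Real.log t| + (|Real.log (4 * Real.pi ^ 2)| + Real.log (1 + 4 * Real.pi ^ 2 * t ^ 2)) := by
  have hp : 0 < 4 * Real.pi ^ 2 * t ^ 2 := by positivity
  have h1 : Real.log (4 * Real.pi ^ 2 * t ^ 2) ≤ Real.log (ε ^ 2 + 4 * Real.pi ^ 2 * t ^ 2) :=
    Real.log_le_log hp (by nlinarith)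
  have h2 : Real.log (ε ^ 2 + 4 * Real.pi ^ 2 * t ^ 2) ≤ Real.log (1 + 4 * Real.pi ^ 2 * t ^ 2) :=
    Real.log_le_log (by positivity) (by nlinarith)
  have h3 : Real.log (4 * Real.pi ^ 2 * t ^ 2) = Real.log (4 * Real.pi ^ 2) + 2 * Real.log t := by
    rw [Real.log_mul (by positivity) (by positivity), Real.log_pow]
    norm_cast
  have h4 : 0 ≤ Real.log (1 + 4 * Real.pi ^ 2 * t ^ 2) := Real.log_nonneg (by linarith)
  rw [smoothLog, abs_le]
  have := neg_abs_le (Real.log t)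
  have := neg_abs_le (Real.log (4 * Real.pi ^ 2))
  have := abs_nonneg (Real.log t)
  have := abs_nonneg (Real.log (4 * Real.pi ^ 2))
  constructor <;> linarith

theorem tendsto_smoothLog {t : ℝ} (ht : t ≠ 0) :
    Tendsto (fun ε => smoothLog ε t) (nhdsWithin 0 (Ioi 0))
      (nhds (Real.log (2 * Real.pi) + Real.log t)) := by
  have h0 : Real.log (2 * Real.pi) + Real.log t = smoothLog 0 t := by
    have : (0 : ℝ) ^ 2 + 4 * Real.pi ^ 2 * t ^ 2 = (2 * Real.pi * t) ^ 2 := by ring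
    rw [smoothLog, this, Real.log_pow, ← Real.log_mul (by positivity) ht]
    push_cast
    ring
  rw [h0]
  have hc : ContinuousAt (fun ε => smoothLog ε t) 0 := by
    refine ContinuousAt.div_const (ContinuousAt.log (by fun_prop) ?_) 2
    positivity
  exact hc.tendsto.mono_left nhdsWithin_le_nhds

/-- The Fourier transform of `log |t|` away from the origin, tested against second derivatives. -/
theorem integral_abs_mul_fourier {H : ℝ → ℂ} (hH : ContDiff ℝ ∞ H) (hc : HasCompactSupport H) :
    (2 * Real.pi ^ 2 : ℂ) * ∫ r : ℝ, ((|r| : ℝ) : ℂ) * 𝓕 H r =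
      ∫ t : ℝ, (Real.log t : ℂ) * deriv (deriv H) t := by
  have hH2 : ContDiff ℝ ∞ (deriv (deriv H)) := ContDiff.deriv' (ContDiff.deriv' hH)
  have hc2 : HasCompactSupport (deriv (deriv H)) := hc.deriv.deriv
  set S : SchwartzMap ℝ ℂ := 𝓕 (hc.toSchwartzMap hH) with hS
  have hSH : 𝓕 H = S := rfl
  have hlim1 : Tendsto (fun ε : ℝ => ∫ r : ℝ, ((|r| * Real.exp (-ε * |r|) : ℝ) : ℂ) * 𝓕 H r)
      (nhdsWithin 0 (Ioi 0)) (nhds (∫ r : ℝ, ((|r| : ℝ) : ℂ) * 𝓕 H r)) := by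
    refine tendsto_integral_filter_of_dominated_convergence (fun r => ‖r‖ ^ 1 * ‖S r‖) ?_ ?_
      (S.integrable_pow_mul volume 1) ?_
    · refine .of_forall fun ε => Continuous.aestronglyMeasurable ?_
      rw [hSH]
      fun_prop
    · filter_upwards [self_mem_nhdsWithin] with ε (hε : 0 < ε)
      refine .of_forall fun r => ?_
      rw [hSH, norm_mul, Complex.norm_real, norm_mul, norm_abs_eq_norm, pow_one]
      have : ‖Real.exp (-ε * |r|)‖ ≤ 1 := by
        rw [Real.norm_of_nonneg (Real.exp_pos _).le, Real.exp_le_one_iff]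
        nlinarith [abs_nonneg r]
      gcongr
      exact mul_le_of_le_one_right (norm_nonneg _) this
    · refine .of_forall fun r => ?_
      have h1 : ContinuousAt (fun ε : ℝ => ((|r| * Real.exp (-ε * |r|) : ℝ) : ℂ) * 𝓕 H r) 0 := by
        fun_prop
      have h2 := h1.tendsto
      simp only [neg_zero, zero_mul, Real.exp_zero, mul_one] at h2
      exact h2.mono_left nhdsWithin_le_nhds
  have hlim2 : Tendsto (fun ε : ℝ => ∫ t, (smoothLog ε t : ℂ) * deriv (deriv H) t)
      (nhdsWithin 0 (Ioi 0))
      (nhds (∫ t : ℝ, ((Real.log (2 * Real.pi) + Real.log t : ℝ) : ℂ) * deriv (deriv H) t)) := by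
    have hne : ∀ᵐ t : ℝ, t ≠ 0 := by simp [ae_iff, measure_singleton]
    refine tendsto_integral_filter_of_dominated_convergence (fun t => ‖(Real.log t : ℂ) *
      deriv (deriv H) t‖ + ‖((|Real.log (4 * Real.pi ^ 2)| +
        Real.log (1 + 4 * Real.pi ^ 2 * t ^ 2) : ℝ) : ℂ) * deriv (deriv H) t‖) ?_ ?_ ?_ ?_
    · filter_upwards [self_mem_nhdsWithin] with ε (hε : 0 < ε)
      have hcont : Continuous (smoothLog ε) :=
        continuous_iff_continuousAt.2 fun t => (hasDerivAt_smoothLog hε t).continuousAt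
      exact ((Complex.continuous_ofReal.comp hcont).mul hH2.continuous).aestronglyMeasurable
    · filter_upwards [Ioc_mem_nhdsGT one_pos] with ε hε
      filter_upwards [hne] with t ht
      rw [norm_mul, norm_mul, norm_mul, ← add_mul, Complex.norm_real, Complex.norm_real,
        Complex.norm_real]
      gcongr
      refine (abs_smoothLog_le hε.1 hε.2 ht).trans ?_
      rw [Real.norm_eq_abs, Real.norm_eq_abs]
      gcongr
      exact le_abs_self _
    · refine (integrable_log_mul hH2.continuous hc2).norm.add (Integrable.norm ?_)
      refine Continuous.integrable_of_hasCompactSupport (Continuous.mul ?_ hH2.continuous)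
        hc2.mul_left
      refine Complex.continuous_ofReal.comp (continuous_const.add (Continuous.log (by fun_prop) ?_))
      intro t
      positivity
    · filter_upwards [hne] with t ht
      exact ((Complex.continuous_ofReal.tendsto _).comp (tendsto_smoothLog ht)).mul_const _
  have heq := tendsto_nhds_unique ((hlim1.const_mul (2 * Real.pi ^ 2 : ℂ)).congr' (by
    filter_upwards [self_mem_nhdsWithin] with ε hε
    exact integral_abs_mul_exp_mul_fourier hH hc hε)) hlim2
  have hH1 : ContDiff ℝ ∞ (deriv H) := ContDiff.deriv' hH
  have hint : Integrable (deriv (deriv H)) := hH2.continuous.integrable_of_hasCompactSupport hc2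
  -- The limit kernel is log|2πt|; its extra constant log 2π is killed because H'' has integral
  -- zero.
  have hzero : ∫ t, deriv (deriv H) t = 0 :=
    integral_eq_zero_of_hasDerivAt_of_integrable
      (fun t => (hH1.differentiable (by simp) t).hasDerivAt) hint
      (hH1.continuous.integrable_of_hasCompactSupport hc.deriv)
  rw [heq]
  simp only [Complex.ofReal_add, add_mul]
  rw [integral_add (hint.const_mul _) (integrable_log_mul hH2.continuous hc2), integral_const_mul,
    hzero, mul_zero, zero_add]

/-- This is `integral_abs_mul_fourier` for the translate H(t) = g^{(k)}(t + s): translation gives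
the character and the derivatives give the power of 2πir. -/
theorem integral_log_abs_sub_mul_iteratedDeriv {g : ℝ → ℂ} (hg : ContDiff ℝ ∞ g)
    (hc : HasCompactSupport g) (k : ℕ) (s : ℝ) :
    ∫ t : ℝ, (Real.log |t - s| : ℂ) * iteratedDeriv (k + 2) g t =
      (2 * Real.pi ^ 2 : ℂ) * ∫ r : ℝ, ((|r| : ℝ) : ℂ) *
        ((Real.fourierChar (s * r) : ℂ) * ((2 * Real.pi * Complex.I * r) ^ k * 𝓕 g r)) := by
  have hgs : ∀ j : ℕ, ContDiff ℝ ∞ (iteratedDeriv j g) := fun j => by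
    induction j with
    | zero => rwa [iteratedDeriv_zero]
    | succ j ih => rw [iteratedDeriv_succ]; exact ContDiff.deriv' ih
  have hgi : ∀ j : ℕ, HasCompactSupport (iteratedDeriv j g) := fun j => by
    induction j with
    | zero => rwa [iteratedDeriv_zero]
    | succ j ih => rw [iteratedDeriv_succ]; exact ih.deriv
  set H : ℝ → ℂ := fun t => iteratedDeriv k g (t + s) with hH
  have hHs : ContDiff ℝ ∞ H := (hgs k).comp (contDiff_id.add contDiff_const)
  have hHc : HasCompactSupport H := (hgi k).comp_homeomorph (Homeomorph.addRight s)
  have hd : ∀ t, deriv (deriv H) t = iteratedDeriv (k + 2) g (t + s) := by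
    intro t
    have h1 : deriv H = fun t => iteratedDeriv (k + 1) g (t + s) := by
      ext t
      rw [hH, deriv_comp_add_const, iteratedDeriv_succ]
    rw [h1, deriv_comp_add_const, ← iteratedDeriv_succ]
  have hF : ∀ r, 𝓕 H r =
      (Real.fourierChar (s * r) : ℂ) * ((2 * Real.pi * Complex.I * r) ^ k * 𝓕 g r) := by
    intro r
    have h1 := congrFun (VectorFourier.fourierIntegral_comp_add_right Real.fourierChar volume
      (innerₗ ℝ) (iteratedDeriv k g) s) r
    have h2 := congrFun (Real.fourier_iteratedDeriv (N := ⊤) (n := k) hg (fun j _ =>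
      (hgs j).continuous.integrable_of_hasCompactSupport (hgi j)) le_top) r
    rw [smul_eq_mul] at h2
    have h3 : 𝓕 H r = Real.fourierChar (inner ℝ s r) • 𝓕 (iteratedDeriv k g) r := h1
    rw [← h2, h3, Circle.smul_def, smul_eq_mul, real_inner_eq_re_inner, RCLike.inner_apply]
    simp [mul_comm]
  rw [← integral_add_right_eq_self _ s]
  simp only [add_sub_cancel_right, Real.log_abs, ← hd, ← hF]
  exact (integral_abs_mul_fourier hHs hHc).symm

end LogKernel

/-! ### The Radon transform on the Fourier side -/

section Radon

variable {n : ℕ} {φ : EuclideanSpace ℝ (Fin n) → ℂ}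

/-- The Radon transform: integrals over the hyperplanes `{x : θ · x = t}`. -/
noncomputable def radon (φ : EuclideanSpace ℝ (Fin n) → ℂ)
    (θ : sphere (0 : EuclideanSpace ℝ (Fin n)) 1) (t : ℝ) : ℂ :=
  ∫ y : (ℝ ∙ θ.1)ᗮ, φ (t • θ.1 + y)

theorem norm_le_norm_smul_add_orthogonal (θ : sphere (0 : EuclideanSpace ℝ (Fin n)) 1) (t : ℝ)
    (y : (ℝ ∙ θ.1)ᗮ) : ‖y‖ ≤ ‖t • θ.1 + (y : EuclideanSpace ℝ (Fin n))‖ := by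
  rw [← sq_le_sq₀ (norm_nonneg _) (norm_nonneg _), norm_smul_add_orthogonal_sq]
  nlinarith

theorem radon_eq_zero (hφ : ∀ p, 1 ≤ ‖p‖ → φ p = 0)
    (θ : sphere (0 : EuclideanSpace ℝ (Fin n)) 1) {t : ℝ} (ht : 1 ≤ |t|) : radon φ θ t = 0 := by
  have (y : (ℝ ∙ θ.1)ᗮ) : φ (t • θ.1 + y) = 0 := by
    refine hφ _ ?_
    rw [← one_le_sq_iff₀ (norm_nonneg _), norm_smul_add_orthogonal_sq, ← sq_abs t]
    nlinarith [norm_nonneg y]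
  simp [radon, this]

theorem hasCompactSupport_radon (hφ : ∀ p, 1 ≤ ‖p‖ → φ p = 0)
    (θ : sphere (0 : EuclideanSpace ℝ (Fin n)) 1) : HasCompactSupport (radon φ θ) := by
  refine HasCompactSupport.intro (isCompact_closedBall 0 1) fun t ht => radon_eq_zero hφ θ ?_
  rw [mem_closedBall_zero_iff, not_le, Real.norm_eq_abs] at ht
  exact ht.le

theorem continuous_radon (hφ : Continuous φ) (hφ0 : ∀ p, 1 ≤ ‖p‖ → φ p = 0)
    (θ : sphere (0 : EuclideanSpace ℝ (Fin n)) 1) : Continuous (radon φ θ) := by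
  have h1 : radon φ θ = fun t => ∫ y in closedBall (0 : (ℝ ∙ θ.1)ᗮ) 1, φ (t • θ.1 + y) := by
    ext t
    refine (setIntegral_eq_integral_of_forall_compl_eq_zero fun y hy => hφ0 _ ?_).symm
    rw [mem_closedBall_zero_iff, not_le] at hy
    exact hy.le.trans (norm_le_norm_smul_add_orthogonal θ t y)
  rw [h1]
  refine continuous_parametric_integral_of_continuous ?_ (isCompact_closedBall _ _)
  exact hφ.comp (by fun_prop)

theorem measurePreserving_smul_add_orthogonal (θ : sphere (0 : EuclideanSpace ℝ (Fin n)) 1) :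
    MeasurePreserving (fun p : ℝ × (ℝ ∙ θ.1)ᗮ => p.1 • θ.1 + (p.2 : EuclideanSpace ℝ (Fin n)))
      volume volume := by
  refine measurePreserving_orthogonal_add
    (LinearIsometry.toSpanSingleton ℝ _ (norm_eq_of_mem_sphere θ)) (ℝ ∙ θ.1)ᗮ.subtypeₗᵢ
    (fun a b => ?_) ?_
  · rw [LinearIsometry.toSpanSingleton_apply, real_inner_smul_left]
    exact mul_eq_zero_of_right _ (Submodule.mem_orthogonal_singleton_iff_inner_right.1 b.2)
  · rw [Module.finrank_self, add_comm]
    exact finrank_orthogonal_add_one (ne_zero_of_mem_unit_sphere θ)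

theorem integral_radon {G : EuclideanSpace ℝ (Fin n) → ℂ} (hG : Integrable G)
    (θ : sphere (0 : EuclideanSpace ℝ (Fin n)) 1) :
    Integrable (radon G θ) ∧ ∫ t, radon G θ t = ∫ x, G x := by
  have hmp := measurePreserving_smul_add_orthogonal θ
  have hint := hmp.integrable_comp_of_integrable hG
  refine ⟨hint.integral_prod_left, ?_⟩
  have h1 : ∫ x, G x = ∫ p : ℝ × (ℝ ∙ θ.1)ᗮ, G (p.1 • θ.1 + p.2) := by
    conv_lhs => rw [← hmp.map_eq]
    rw [integral_map hmp.measurable.aemeasurable]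
    rw [hmp.map_eq]
    exact hG.1
  rw [h1]
  exact (integral_prod _ hint).symm

/-- The Fourier slice theorem. -/
theorem fourier_radon (hφ : Integrable φ) (θ : sphere (0 : EuclideanSpace ℝ (Fin n)) 1) (r : ℝ) :
    𝓕 (radon φ θ) r = 𝓕 φ (r • θ.1) := by
  have hG : Integrable fun x : EuclideanSpace ℝ (Fin n) =>
      Real.fourierChar (-(inner ℝ x (r • θ.1))) • φ x :=
    (Real.fourierIntegral_convergent_iff _).2 hφ
  rw [Real.fourier_eq, Real.fourier_eq, ← (integral_radon hG θ).2]
  refine integral_congr_ae (.of_forall fun t => ?_)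
  -- The phase is constant on each hyperplane, so it leaves the inner integral of Fubini.
  have h1 : ∀ y : (ℝ ∙ θ.1)ᗮ, inner ℝ (t • θ.1 + (y : EuclideanSpace ℝ (Fin n))) (r • θ.1) =
      inner ℝ t r := by
    intro y
    have : inner ℝ (y : EuclideanSpace ℝ (Fin n)) θ.1 = 0 :=
      Submodule.mem_orthogonal_singleton_iff_inner_left.1 y.2
    rw [inner_smul_right, inner_add_left, real_inner_smul_left, this, real_inner_self_eq_norm_sq,
      norm_eq_of_mem_sphere]
    simp
  simp only [radon, h1, Circle.smul_def]
  rw [integral_smul]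

/-- The restriction of a Schwartz function to the line spanned by a unit vector. -/
noncomputable def rayRestriction (ψ : SchwartzMap (EuclideanSpace ℝ (Fin n)) ℂ)
    (θ : sphere (0 : EuclideanSpace ℝ (Fin n)) 1) : SchwartzMap ℝ ℂ :=
  SchwartzMap.compCLMOfAntilipschitz ℂ
    (LinearIsometry.toSpanSingleton ℝ _
      (norm_eq_of_mem_sphere θ)).toContinuousLinearMap.hasTemperateGrowth
    (LinearIsometry.toSpanSingleton ℝ _ (norm_eq_of_mem_sphere θ)).antilipschitz ψ

theorem rayRestriction_apply (ψ : SchwartzMap (EuclideanSpace ℝ (Fin n)) ℂ)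
    (θ : sphere (0 : EuclideanSpace ℝ (Fin n)) 1) (r : ℝ) :
    rayRestriction ψ θ r = ψ (r • θ.1) := rfl

/-- Fourier inversion applied to the slice theorem. Since φ̂ restricted to a line is Schwartz,
smoothness and the derivative formulas of the Radon transform follow without differentiating under
hyperplane integrals. -/
theorem radon_eq_fourierInv (φ : SchwartzMap (EuclideanSpace ℝ (Fin n)) ℂ)
    (hφ0 : ∀ p, 1 ≤ ‖p‖ → φ p = 0) (θ : sphere (0 : EuclideanSpace ℝ (Fin n)) 1) :
    radon φ θ = (𝓕⁻ (rayRestriction (𝓕 φ) θ) : SchwartzMap ℝ ℂ) := by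
  have h1 : 𝓕 (radon φ θ) = rayRestriction (𝓕 φ) θ := by
    ext r
    rw [fourier_radon φ.integrable, rayRestriction_apply, SchwartzMap.fourier_coe]
  rw [SchwartzMap.fourierInv_coe, ← h1]
  refine (Continuous.fourierInv_fourier_eq (continuous_radon φ.continuous hφ0 θ)
    (integral_radon φ.integrable θ).1 ?_).symm
  rw [h1]
  exact SchwartzMap.integrable _

theorem contDiff_radon (φ : SchwartzMap (EuclideanSpace ℝ (Fin n)) ℂ)
    (hφ0 : ∀ p, 1 ≤ ‖p‖ → φ p = 0) (θ : sphere (0 : EuclideanSpace ℝ (Fin n)) 1) :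
    ContDiff ℝ ∞ (radon φ θ) := by
  rw [radon_eq_fourierInv φ hφ0]
  exact SchwartzMap.smooth _ _

theorem iteratedDeriv_radon (φ : SchwartzMap (EuclideanSpace ℝ (Fin n)) ℂ)
    (hφ0 : ∀ p, 1 ≤ ‖p‖ → φ p = 0) (θ : sphere (0 : EuclideanSpace ℝ (Fin n)) 1) (k : ℕ)
    (s : ℝ) :
    iteratedDeriv k (radon φ θ) s = ∫ r : ℝ, (Real.fourierChar (r * s) : ℂ) *
      ((2 * Real.pi * Complex.I * r) ^ k * 𝓕 φ (r • θ.1)) := by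
  set ψ := rayRestriction (𝓕 φ) θ with hψ
  have hint : ∀ m : ℕ, (m : ℕ∞) ≤ ⊤ → Integrable fun r : ℝ => r ^ m • ψ (-r) := by
    intro m _
    refine ((SchwartzMap.integrable_pow_mul volume ψ m).comp_neg.mono'
      (Continuous.aestronglyMeasurable (by fun_prop)) (.of_forall fun r => ?_))
    rw [norm_smul, norm_pow, norm_neg]
  rw [radon_eq_fourierInv φ hφ0, SchwartzMap.fourierInv_coe, Real.fourierInv_eq_fourier_comp_neg,
    Real.iteratedDeriv_fourier hint le_top, Real.fourier_real_eq, ← integral_neg_eq_self]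
  refine integral_congr_ae (.of_forall fun r => ?_)
  simp only [neg_neg, Circle.smul_def, smul_eq_mul, hψ, rayRestriction_apply, neg_mul,
    Complex.ofReal_neg, mul_neg]

/-- The oscillatory integral `∫ |r|^m φ̂(rθ) e^{2πirs} dr`. -/
noncomputable def rieszRay (φ : EuclideanSpace ℝ (Fin n) → ℂ) (m : ℕ)
    (θ : sphere (0 : EuclideanSpace ℝ (Fin n)) 1) (s : ℝ) : ℂ :=
  ∫ r : ℝ, (Real.fourierChar (r * s) : ℂ) * (((|r| ^ m : ℝ) : ℂ) * 𝓕 φ (r • θ.1))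

theorem iteratedDeriv_radon_of_even (φ : SchwartzMap (EuclideanSpace ℝ (Fin n)) ℂ)
    (hφ0 : ∀ p, 1 ≤ ‖p‖ → φ p = 0) (θ : sphere (0 : EuclideanSpace ℝ (Fin n)) 1) {k : ℕ}
    (hk : Even k) (s : ℝ) :
    iteratedDeriv k (radon φ θ) s = (2 * Real.pi * Complex.I) ^ k * rieszRay φ k θ s := by
  rw [iteratedDeriv_radon φ hφ0, rieszRay, ← integral_const_mul]
  refine integral_congr_ae (.of_forall fun r => ?_)
  simp only [hk.pow_abs, mul_pow, SchwartzMap.fourier_coe]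
  push_cast
  ring

theorem iteratedDeriv_radon_eq_zero {φ : EuclideanSpace ℝ (Fin n) → ℂ}
    (hφ0 : ∀ p, 1 ≤ ‖p‖ → φ p = 0)
    (θ : sphere (0 : EuclideanSpace ℝ (Fin n)) 1) (k : ℕ) {t : ℝ} (ht : t ∉ Icc (-1 : ℝ) 1) :
    iteratedDeriv k (radon φ θ) t = 0 := by
  have h : radon φ θ =ᶠ[nhds t] fun _ => 0 := by
    filter_upwards [isClosed_Icc.isOpen_compl.mem_nhds ht] with u hu
    refine radon_eq_zero hφ0 θ ?_
    by_contra! h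
    exact hu (abs_le.1 h.le)
  rw [h.iteratedDeriv_eq]
  simp

/-- The derivatives of the Radon transform vanish off [-1, 1], so the integral runs over the whole
line. The logarithm supplies one factor |r|; since k is even, r^k = |r|^k. -/
theorem intervalIntegral_log_radon (φ : SchwartzMap (EuclideanSpace ℝ (Fin n)) ℂ)
    (hφ0 : ∀ p, 1 ≤ ‖p‖ → φ p = 0) (θ : sphere (0 : EuclideanSpace ℝ (Fin n)) 1) {k : ℕ}
    (hk : Even k) (s : ℝ) :
    ∫ t in (-1 : ℝ)..1, (Real.log |t - s| : ℂ) * iteratedDeriv (k + 2) (radon φ θ) t =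
      2 * Real.pi ^ 2 * (2 * Real.pi * Complex.I) ^ k * rieszRay φ (k + 1) θ s := by
  rw [intervalIntegral.integral_of_le (by norm_num), ← integral_Icc_eq_integral_Ioc,
    setIntegral_eq_integral_of_forall_compl_eq_zero fun t ht => by
      rw [iteratedDeriv_radon_eq_zero hφ0 θ _ ht, mul_zero],
    integral_log_abs_sub_mul_iteratedDeriv (contDiff_radon φ hφ0 θ) (hasCompactSupport_radon hφ0 θ),
    rieszRay, mul_assoc (2 * (Real.pi : ℂ) ^ 2), ← integral_const_mul ((2 * Real.pi * Complex.I) ^ k)]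
  congr 1
  refine integral_congr_ae (.of_forall fun r => ?_)
  simp only [pow_succ, hk.pow_abs, fourier_radon φ.integrable, mul_pow, mul_comm s r]
  push_cast
  ring

end Radon

/-! ### Polar coordinates and the Newtonian potential -/

section Polar

variable {E : Type*} [NormedAddCommGroup E] [InnerProductSpace ℝ E] [FiniteDimensional ℝ E]
  [MeasurableSpace E] [BorelSpace E]

theorem integral_volumeIoiPow (k : ℕ) (g : ℝ → ℂ) :
    ∫ r : Ioi (0 : ℝ), g r ∂(Measure.volumeIoiPow k) = ∫ r in Ioi (0 : ℝ), (r ^ k : ℝ) • g r := by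
  simp only [Measure.volumeIoiPow, ENNReal.ofReal]
  rw [integral_withDensity_eq_integral_smul,
    integral_subtype_comap measurableSet_Ioi fun a => Real.toNNReal (a ^ k) • g a,
    setIntegral_congr_fun measurableSet_Ioi fun x hx => ?_]
  · rw [NNReal.smul_def, Real.coe_toNNReal _ (pow_nonneg hx.out.le _)]
  · exact (measurable_subtype_coe.pow_const _).real_toNNReal

/-- Integration in polar coordinates. -/
theorem integral_polar [Nontrivial E] {G : E → ℂ} (hG : Integrable G) :
    Integrable (fun θ : sphere (0 : E) 1 =>
        ∫ r in Ioi (0 : ℝ), (r ^ (Module.finrank ℝ E - 1) : ℝ) • G (r • θ.1)) (surfaceMeasure E) ∧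
      ∫ θ : sphere (0 : E) 1,
        (∫ r in Ioi (0 : ℝ), (r ^ (Module.finrank ℝ E - 1) : ℝ) • G (r • θ.1)) ∂(surfaceMeasure E) =
        ∫ x, G x := by
  have hmp := (volume : Measure E).measurePreserving_homeomorphUnitSphereProd
  have hemb := (homeomorphUnitSphereProd E).measurableEmbedding
  set Q : sphere (0 : E) 1 × Ioi (0 : ℝ) → ℂ := fun q => G (q.2.1 • q.1.1) with hQ
  have hQe : ∀ x : ({0}ᶜ : Set E), Q (homeomorphUnitSphereProd E x) = G x := by
    intro x
    have hx : ‖(x : E)‖ ≠ 0 := norm_ne_zero_iff.2 x.2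
    simp [hQ, smul_smul, hx]
  have hint0 : Integrable (fun x : ({0}ᶜ : Set E) => G x) ((volume : Measure E).comap (↑)) := by
    have := hG.integrableOn (s := ({0}ᶜ : Set E))
    rwa [integrableOn_iff_comap_subtypeVal (measurableSet_singleton _).compl] at this
  have hint : Integrable Q ((volume : Measure E).toSphere.prod
      (Measure.volumeIoiPow (Module.finrank ℝ E - 1))) := by
    rw [← hmp.integrable_comp_emb hemb]
    exact hint0.congr (.of_forall fun x => (hQe x).symm)
  have hinner : ∀ θ : sphere (0 : E) 1,
      ∫ r : Ioi (0 : ℝ), Q (θ, r) ∂(Measure.volumeIoiPow (Module.finrank ℝ E - 1)) =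
        ∫ r in Ioi (0 : ℝ), (r ^ (Module.finrank ℝ E - 1) : ℝ) • G (r • θ.1) := fun θ =>
    integral_volumeIoiPow _ fun r => G (r • θ.1)
  simp only [← hinner, surfaceMeasure]
  refine ⟨hint.integral_prod_left, ?_⟩
  rw [← integral_prod _ hint, ← hmp.integral_comp hemb]
  simp only [hQe]
  rw [integral_subtype_comap (measurableSet_singleton _).compl G, restrict_compl_singleton]

/-- Near the origin the radial density is r^{d-1} r^{-2} = r^{d-3}, integrable because d ≥ 3;
outside the unit ball the weight is at most 1. -/
theorem integrable_norm_inv_sq_mul (hd : 3 ≤ Module.finrank ℝ E) (ψ : SchwartzMap E ℂ) :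
    Integrable fun ξ : E => (((‖ξ‖ ^ 2)⁻¹ : ℝ) : ℂ) * ψ ξ := by
  have : Nontrivial E := Module.nontrivial_of_finrank_pos (R := ℝ) (by omega)
  obtain ⟨C, hC⟩ : ∃ C, ∀ ξ, ‖ψ ξ‖ ≤ C := ⟨_, ψ.norm_le_seminorm ℂ⟩
  have hball : IntegrableOn (fun ξ : E => (‖ξ‖ ^ 2)⁻¹) (ball 0 1) := by
    rw [integrableOn_fun_norm_addHaar volume (f := fun y : ℝ => (y ^ 2)⁻¹)]
    have hc : IntegrableOn (fun y : ℝ => y ^ (Module.finrank ℝ E - 3)) (Ioo 0 1) :=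
      ((continuous_pow _).integrableOn_Icc (a := (0 : ℝ)) (b := 1)).mono_set Ioo_subset_Icc_self
    refine hc.congr_fun (fun y hy => ?_) measurableSet_Ioo
    have hy0 : y ≠ 0 := hy.1.ne'
    have : y ^ (Module.finrank ℝ E - 1) = y ^ (Module.finrank ℝ E - 3) * y ^ 2 := by
      rw [← pow_add]; congr 1; omega
    simp only [smul_eq_mul, this]
    field_simp
  rw [← integrable_indicator_iff measurableSet_ball] at hball
  refine ((hball.const_mul C).add ψ.integrable.norm).mono' ?_ (.of_forall fun ξ => ?_)
  · refine Measurable.aestronglyMeasurable (Measurable.mul (by fun_prop) ψ.continuous.measurable)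
  · rw [norm_mul, Complex.norm_real, Real.norm_of_nonneg (by positivity), Pi.add_apply]
    by_cases hξ : ‖ξ‖ < 1
    · rw [indicator_of_mem (mem_ball_zero_iff.2 hξ), mul_comm]
      have : ‖ψ ξ‖ * (‖ξ‖ ^ 2)⁻¹ ≤ C * (‖ξ‖ ^ 2)⁻¹ := by gcongr; exact hC ξ
      linarith [norm_nonneg (ψ ξ)]
    · rw [indicator_of_notMem (by rwa [mem_ball_zero_iff]), mul_zero, zero_add]
      refine mul_le_of_le_one_left (norm_nonneg _) (inv_le_one_of_one_le₀ ?_)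
      exact one_le_pow₀ (not_lt.1 hξ)

/-- Convolution of `φ` with a multiple of the Newtonian kernel, as a Fourier integral. -/
noncomputable def newtonPotential (ψ : SchwartzMap E ℂ) : E → ℂ :=
  𝓕⁻ fun ξ : E => (((‖ξ‖ ^ 2)⁻¹ : ℝ) : ℂ) * ψ ξ

/-- Moments up to order two are what a C² Fourier integral requires. The argument is reflected
because the inverse transform is handled as the forward transform of the reflected function. -/
theorem integrable_norm_pow_mul_newton (hd : 3 ≤ Module.finrank ℝ E) (ψ : SchwartzMap E ℂ) (j : ℕ)
    (hj : j ≤ 2) :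
    Integrable fun ξ : E => ‖ξ‖ ^ j * ‖(((‖-ξ‖ ^ 2)⁻¹ : ℝ) : ℂ) * ψ (-ξ)‖ := by
  have h := (integrable_norm_inv_sq_mul hd ψ).comp_neg
  refine (h.norm.add ψ.integrable.comp_neg.norm).mono' ?_ (.of_forall fun ξ => ?_)
  · exact (continuous_norm.pow j).aestronglyMeasurable.mul h.norm.1
  · rw [norm_mul, norm_pow, norm_norm, norm_norm, Pi.add_apply]
    by_cases hξ : ‖ξ‖ < 1
    · have := mul_le_of_le_one_left (norm_nonneg ((((‖-ξ‖ ^ 2)⁻¹ : ℝ) : ℂ) * ψ (-ξ)))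
        (pow_le_one₀ (norm_nonneg ξ) hξ.le (n := j))
      linarith [norm_nonneg (ψ (-ξ))]
    · have h1 : 1 ≤ ‖ξ‖ := not_lt.1 hξ
      have h2 : ‖ξ‖ ^ j * (‖ξ‖ ^ 2)⁻¹ ≤ 1 := by
        rw [← div_eq_mul_inv]
        exact div_le_one_of_le₀ (pow_le_pow_right₀ h1 hj) (by positivity)
      have h3 : ‖ξ‖ ^ j * ‖(((‖-ξ‖ ^ 2)⁻¹ : ℝ) : ℂ) * ψ (-ξ)‖ ≤ ‖ψ (-ξ)‖ := by
        rw [norm_mul, Complex.norm_real, Real.norm_of_nonneg (by positivity), norm_neg, ← mul_assoc]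
        exact mul_le_of_le_one_left (norm_nonneg _) h2
      linarith [norm_nonneg ((((‖-ξ‖ ^ 2)⁻¹ : ℝ) : ℂ) * ψ (-ξ))]

theorem contDiff_newtonPotential (hd : 3 ≤ Module.finrank ℝ E) (ψ : SchwartzMap E ℂ) :
    ContDiff ℝ 2 (newtonPotential ψ) := by
  rw [newtonPotential, Real.fourierInv_eq_fourier_comp_neg]
  refine Real.contDiff_fourier (N := 2) fun j hj => integrable_norm_pow_mul_newton hd ψ j ?_
  exact_mod_cast hj

/-- Each second derivative along an orthonormal basis vector multiplies the integrand by -4π²⟨v, b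
i⟩²; by Parseval these sum to -4π²|v|², which cancels |v|^{-2} off the origin. -/
theorem laplacian_newtonPotential (hd : 3 ≤ Module.finrank ℝ E) (ψ : SchwartzMap E ℂ) (x : E) :
    Laplacian.laplacian (newtonPotential ψ) x = -(4 * Real.pi ^ 2 : ℂ) * 𝓕⁻ (ψ : E → ℂ) x := by
  have : Nontrivial E := Module.nontrivial_of_finrank_pos (R := ℝ) (by omega)
  set h : E → ℂ := fun ξ => (((‖-ξ‖ ^ 2)⁻¹ : ℝ) : ℂ) * ψ (-ξ) with hh
  have hint := integrable_norm_pow_mul_newton hd ψ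
  have hm : AEStronglyMeasurable h := (integrable_norm_inv_sq_mul hd ψ).comp_neg.1
  set b := stdOrthonormalBasis ℝ E
  have hpint : Integrable fun v => VectorFourier.fourierPowSMulRight (innerSL ℝ) h v 2 :=
    VectorFourier.integrable_fourierPowSMulRight _ (hint 2 le_rfl) hm
  have hterm : ∀ i, iteratedFDeriv ℝ 2 (newtonPotential ψ) x ![b i, b i] =
      ∫ v, Real.fourierChar (-inner ℝ v x) • (-(4 * Real.pi ^ 2 : ℂ) * (inner ℝ v (b i) : ℝ) ^ 2 * h v) := by
    intro i
    rw [newtonPotential, Real.fourierInv_eq_fourier_comp_neg,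
      Real.iteratedFDeriv_fourier (N := 2) (fun j hj => hint j (by exact_mod_cast hj)) hm le_rfl,
      Real.fourier_continuousMultilinearMap_apply hpint, Real.fourier_eq]
    refine integral_congr_ae (.of_forall fun v => ?_)
    have hin : ∀ w : E, innerSL ℝ v w = inner ℝ v w := fun _ => rfl
    simp only [VectorFourier.fourierPowSMulRight_apply, hin, Fin.prod_univ_two,
      Matrix.cons_val_zero, Matrix.cons_val_one, Complex.real_smul, smul_eq_mul]
    congr 1
    have := Complex.I_sq
    push_cast
    linear_combination (4 * Real.pi ^ 2 * (inner ℝ v (b i) : ℝ) ^ 2 * h v : ℂ) * this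
  have hterm_int : ∀ i, Integrable fun v => Real.fourierChar (-inner ℝ v x) •
      (-(4 * Real.pi ^ 2 : ℂ) * (inner ℝ v (b i) : ℝ) ^ 2 * h v) := by
    intro i
    rw [Real.fourierIntegral_convergent_iff]
    refine ((hint 2 le_rfl).const_mul (4 * Real.pi ^ 2)).mono' ?_ (.of_forall fun v => ?_)
    · exact (Continuous.aestronglyMeasurable (by fun_prop)).mul hm
    · rw [norm_mul, norm_mul, norm_neg, norm_pow, Complex.norm_real, mul_assoc]
      have h1 : ‖(4 * Real.pi ^ 2 : ℂ)‖ = 4 * Real.pi ^ 2 := by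
        rw [norm_mul, norm_pow, Complex.norm_real, Real.norm_of_nonneg Real.pi_pos.le]
        norm_num
      have h2 : ‖(inner ℝ v (b i) : ℝ)‖ ≤ ‖v‖ := by
        simpa using norm_inner_le_norm (𝕜 := ℝ) v (b i)
      rw [h1]
      gcongr
  rw [laplacian_eq_iteratedFDeriv_orthonormalBasis _ b]
  simp only [hterm]
  rw [← integral_finsetSum _ fun i _ => hterm_int i, Real.fourierInv_eq_fourier_comp_neg,
    Real.fourier_eq, ← integral_const_mul]
  refine integral_congr_ae ?_
  filter_upwards [compl_mem_ae_iff.2 (measure_singleton (0 : E))] with v hv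
  have hv0 : (‖v‖ : ℂ) ≠ 0 := by exact_mod_cast norm_ne_zero_iff.2 hv
  have hsum : ∑ i, ((inner ℝ v (b i) : ℝ) : ℂ) ^ 2 = (‖v‖ : ℂ) ^ 2 := by
    have := b.sum_sq_norm_inner_left v
    simp only [Real.norm_eq_abs, sq_abs] at this
    exact_mod_cast this
  rw [← Finset.smul_sum, ← Finset.sum_mul, ← Finset.mul_sum, hsum, hh]
  simp only [Circle.smul_def, smul_eq_mul, norm_neg]
  push_cast
  field_simp

end Polar

/-! ### Integration over all directions -/

section Backprojection

variable {n : ℕ}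

/-- Since |r|^{n-3} = |r|^{n-1} |rθ|^{-2}, each half of the line through θ carries a polar
integrand, for G and for its reflection. The two volume integrals agree, hence the factor 2. -/
theorem integral_rieszRay (hn : 3 ≤ n) (φ : SchwartzMap (EuclideanSpace ℝ (Fin n)) ℂ)
    (p : EuclideanSpace ℝ (Fin n)) :
    Integrable (fun θ : sphere (0 : EuclideanSpace ℝ (Fin n)) 1 =>
        rieszRay φ (n - 3) θ (inner ℝ θ.1 p)) (surfaceMeasure (EuclideanSpace ℝ (Fin n))) ∧
      ∫ θ : sphere (0 : EuclideanSpace ℝ (Fin n)) 1, rieszRay φ (n - 3) θ (inner ℝ θ.1 p)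
        ∂(surfaceMeasure (EuclideanSpace ℝ (Fin n))) = 2 * newtonPotential (𝓕 φ) p := by
  have hd : 3 ≤ Module.finrank ℝ (EuclideanSpace ℝ (Fin n)) := by
    rwa [finrank_euclideanSpace_fin]
  have : Nontrivial (EuclideanSpace ℝ (Fin n)) :=
    Module.nontrivial_of_finrank_pos (R := ℝ) (by omega)
  set G : EuclideanSpace ℝ (Fin n) → ℂ := fun ξ =>
    Real.fourierChar (inner ℝ ξ p) • ((((‖ξ‖ ^ 2)⁻¹ : ℝ) : ℂ) * 𝓕 φ ξ) with hG
  have hGint : Integrable G := by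
    have := (Real.fourierIntegral_convergent_iff (-p)).2 (integrable_norm_inv_sq_mul hd (𝓕 φ))
    simpa only [inner_neg_right, neg_neg] using this
  have h1 := integral_polar hGint
  have h2 := integral_polar hGint.comp_neg
  have hsplit : ∀ θ : sphere (0 : EuclideanSpace ℝ (Fin n)) 1,
      rieszRay φ (n - 3) θ (inner ℝ θ.1 p) =
        (∫ r in Ioi (0 : ℝ), (r ^ (Module.finrank ℝ (EuclideanSpace ℝ (Fin n)) - 1) : ℝ) •
          G (r • θ.1)) +
        ∫ r in Ioi (0 : ℝ), (r ^ (Module.finrank ℝ (EuclideanSpace ℝ (Fin n)) - 1) : ℝ) •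
          G (-(r • θ.1)) := by
    intro θ
    set K : ℝ → ℂ := fun r => (Real.fourierChar (r * inner ℝ θ.1 p) : ℂ) *
      (((|r| ^ (n - 3) : ℝ) : ℂ) * 𝓕 φ (r • θ.1)) with hK
    have hKint : Integrable K := by
      have h := ((rayRestriction (𝓕 φ) θ).integrable_pow_mul volume (n - 3))
      refine h.mono' (Continuous.aestronglyMeasurable ?_) (.of_forall fun r => ?_)
      · have : Continuous fun r : ℝ => 𝓕 φ (r • θ.1) := (𝓕 φ).continuous.comp (by fun_prop)
        have he : Continuous fun r : ℝ => (Real.fourierChar (r * inner ℝ θ.1 p) : ℂ) :=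
          continuous_subtype_val.comp (Real.continuous_fourierChar.comp (by fun_prop))
        fun_prop
      · rw [hK, norm_mul, Circle.norm_coe, one_mul, norm_mul, Complex.norm_real, norm_pow,
          norm_abs_eq_norm, rayRestriction_apply]
    have hKG : ∀ r : ℝ, r ≠ 0 → K r = (|r| ^ (n - 1) : ℝ) • G (r • θ.1) := by
      intro r hr
      have hr' : ((|r| : ℝ) : ℂ) ≠ 0 := by exact_mod_cast abs_ne_zero.2 hr
      have hpow : ((|r| : ℝ) : ℂ) ^ (n - 1) = ((|r| : ℝ) : ℂ) ^ (n - 3) * ((|r| : ℝ) : ℂ) ^ 2 := by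
        rw [← pow_add]; congr 1; omega
      simp only [hK, hG, norm_smul, norm_eq_of_mem_sphere, mul_one, real_inner_smul_left,
        Circle.smul_def, smul_eq_mul, Complex.real_smul, Real.norm_eq_abs]
      push_cast
      rw [hpow]
      field_simp
    have hsum : rieszRay φ (n - 3) θ (inner ℝ θ.1 p) =
        (∫ r in Ioi (0 : ℝ), K r) + ∫ r in Ioi (0 : ℝ), K (-r) := by
      rw [integral_comp_neg_Ioi, neg_zero, add_comm, ← compl_Iic,
        integral_add_compl measurableSet_Iic hKint]
      rfl
    rw [hsum, finrank_euclideanSpace_fin]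
    congr 1
    · refine setIntegral_congr_fun measurableSet_Ioi fun r (hr : 0 < r) => ?_
      rw [hKG r hr.ne', abs_of_pos hr]
    · refine setIntegral_congr_fun measurableSet_Ioi fun r (hr : 0 < r) => ?_
      rw [hKG (-r) (neg_ne_zero.2 hr.ne'), abs_neg, abs_of_pos hr, neg_smul]
  simp only [hsplit]
  refine ⟨h1.1.add h2.1, ?_⟩
  rw [integral_add h1.1 h2.1, h1.2, h2.2, integral_neg_eq_self, ← two_mul, newtonPotential,
    Real.fourierInv_eq]

end Backprojection

/-! ### Constants and the complex-valued inversion formulas -/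

section Inversion

variable {n : ℕ}

/-- Legendre's duplication formula at (n-1)/2 turns the product of Gamma values into (n-2)!
2^{-(n-2)} √π. -/
theorem inversionConst_mul (hn : 2 < n) :
    inversionConst n * (4 * (2 * Real.pi) ^ (n - 1)) = (-1) ^ (n / 2 - 1) := by
  obtain ⟨m, rfl⟩ : ∃ m, n = m + 2 := ⟨n - 2, by omega⟩
  have hπ := Real.pi_pos
  have hG : Real.Gamma ((((m + 2 : ℕ) : ℝ) - 1) / 2) * Real.Gamma (((m + 2 : ℕ) : ℝ) / 2) =
      m.factorial * (2 ^ m)⁻¹ * √Real.pi := by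
    have h := Real.Gamma_mul_Gamma_add_half ((((m + 2 : ℕ) : ℝ) - 1) / 2)
    have e1 : (((m + 2 : ℕ) : ℝ) - 1) / 2 + 1 / 2 = ((m + 2 : ℕ) : ℝ) / 2 := by ring
    have e2 : 2 * ((((m + 2 : ℕ) : ℝ) - 1) / 2) = m + 1 := by push_cast; ring
    have e3 : (1 : ℝ) - (m + 1) = -(m : ℝ) := by ring
    rw [e1, e2, e3, Real.Gamma_nat_eq_factorial, Real.rpow_neg two_pos.le, Real.rpow_natCast] at h
    exact h
  have hpow : Real.pi ^ (((m + 2 : ℕ) : ℝ) - 1 / 2) = Real.pi ^ (m + 1) * √Real.pi := by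
    rw [Real.sqrt_eq_rpow, ← Real.rpow_natCast, ← Real.rpow_add hπ]
    congr 1
    push_cast
    ring
  have hs : √Real.pi ≠ 0 := (Real.sqrt_pos.2 hπ).ne'
  rw [inversionConst, mul_assoc ((-1 : ℝ) ^ ((m + 2) / 2 - 1)), hG, hpow]
  simp only [Nat.add_sub_cancel, show m + 2 - 1 = m + 1 by omega]
  field_simp
  ring

/-- Common to both parities, which differ only in c: the backprojection is 2c times a Newtonian
potential, whose Laplacian is -4π²φ. -/
theorem backprojection_const_mul_rieszRay (hn : 2 < n)
    (φ : SchwartzMap (EuclideanSpace ℝ (Fin n)) ℂ) (c : ℂ)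
    {K : sphere (0 : EuclideanSpace ℝ (Fin n)) 1 → ℝ → ℂ}
    (hK : ∀ θ s, K θ s = c * rieszRay φ (n - 3) θ s) :
    (∀ p : EuclideanSpace ℝ (Fin n),
      Integrable (fun θ : sphere (0 : EuclideanSpace ℝ (Fin n)) 1 => K θ (inner ℝ θ.1 p))
        (surfaceMeasure (EuclideanSpace ℝ (Fin n)))) ∧
    ContDiff ℝ 2 (backprojection K) ∧
    ∀ p, Laplacian.laplacian (backprojection K) p = -(8 * Real.pi ^ 2 * c) * φ p := by
  have hd : 3 ≤ Module.finrank ℝ (EuclideanSpace ℝ (Fin n)) := by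
    rwa [finrank_euclideanSpace_fin]
  have hB : backprojection K = (2 * c) • newtonPotential (𝓕 φ) := by
    ext p
    simp only [backprojection, hK]
    rw [integral_const_mul, (integral_rieszRay hn φ p).2, Pi.smul_apply, smul_eq_mul]
    ring
  have hN := contDiff_newtonPotential hd (𝓕 φ)
  refine ⟨fun p => ?_, ?_, fun p => ?_⟩
  · simp only [hK]
    exact (integral_rieszRay hn φ p).1.const_mul c
  · rw [hB]
    exact hN.const_smul (2 * c)
  · have hinv : 𝓕⁻ ⇑(𝓕 φ : SchwartzMap (EuclideanSpace ℝ (Fin n)) ℂ) p = φ p := by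
      rw [← SchwartzMap.fourierInv_coe, FourierTransform.fourierInv_fourier_eq]
    rw [hB, laplacian_smul _ hN.contDiffAt, laplacian_newtonPotential hd, hinv, smul_eq_mul]
    ring

variable {f : sphere (0 : EuclideanSpace ℝ (Fin (n + 1))) 1 → ℂ}

/-- The projected density as a Schwartz function. -/
noncomputable def IsSmoothEvenVanishing.density (hf : IsSmoothEvenVanishing f) :
    SchwartzMap (EuclideanSpace ℝ (Fin n)) ℂ :=
  HasCompactSupport.toSchwartzMap hasCompactSupport_projectedDensity
    hf.contDiff_projectedDensity

theorem IsSmoothEvenVanishing.density_apply (hf : IsSmoothEvenVanishing f)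
    (p : EuclideanSpace ℝ (Fin n)) : hf.density p = projectedDensity f p := rfl

theorem IsSmoothEvenVanishing.density_eq_zero (hf : IsSmoothEvenVanishing f)
    (p : EuclideanSpace ℝ (Fin n)) (hp : 1 ≤ ‖p‖) : hf.density p = 0 :=
  projectedDensity_of_one_le_norm hp

theorem IsSmoothEvenVanishing.weighted_eq (hf : IsSmoothEvenVanishing f)
    (θ : sphere (0 : EuclideanSpace ℝ (Fin n)) 1) :
    weighted (verticalSlice f) θ = (2 : ℝ) • radon hf.density θ := by
  ext t
  rw [hf.weighted_verticalSlice_eq]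
  rfl

theorem IsSmoothEvenVanishing.contDiff_weighted (hf : IsSmoothEvenVanishing f)
    (θ : sphere (0 : EuclideanSpace ℝ (Fin n)) 1) :
    ContDiff ℝ ∞ (weighted (verticalSlice f) θ) := by
  rw [hf.weighted_eq]
  exact (contDiff_radon _ hf.density_eq_zero θ).const_smul (2 : ℝ)

theorem IsSmoothEvenVanishing.iteratedDeriv_weighted (hf : IsSmoothEvenVanishing f)
    (θ : sphere (0 : EuclideanSpace ℝ (Fin n)) 1) (k : ℕ) (t : ℝ) :
    iteratedDeriv k (weighted (verticalSlice f) θ) t =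
      2 * iteratedDeriv k (radon hf.density θ) t := by
  rw [hf.weighted_eq, iteratedDeriv_const_smul_field, Complex.real_smul]
  norm_num

theorem IsSmoothEvenVanishing.oddKernel_eq (hf : IsSmoothEvenVanishing f) (hn : 2 < n)
    (hodd : Odd n) (θ : sphere (0 : EuclideanSpace ℝ (Fin n)) 1) (s : ℝ) :
    oddKernel (verticalSlice f) θ s =
      (2 * (2 * Real.pi * Complex.I) ^ (n - 3)) * rieszRay hf.density (n - 3) θ s := by
  have hk : Even (n - 3) := by
    obtain ⟨m, rfl⟩ := hodd
    exact ⟨m - 1, by omega⟩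
  rw [oddKernel, hf.iteratedDeriv_weighted, iteratedDeriv_radon_of_even _ hf.density_eq_zero θ hk]
  ring

theorem IsSmoothEvenVanishing.evenKernel_eq (hf : IsSmoothEvenVanishing f) (hn : 2 < n)
    (heven : Even n) (θ : sphere (0 : EuclideanSpace ℝ (Fin n)) 1) (s : ℝ) :
    evenKernel (verticalSlice f) θ s =
      (4 * Real.pi ^ 2 * (2 * Real.pi * Complex.I) ^ (n - 4)) *
        rieszRay hf.density (n - 3) θ s := by
  have hk : Even (n - 4) := by
    obtain ⟨m, rfl⟩ := heven
    exact ⟨m - 2, by omega⟩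
  have h4 : 4 ≤ n := by
    obtain ⟨m, rfl⟩ := heven
    omega
  have h := intervalIntegral_log_radon _ hf.density_eq_zero θ hk s
  rw [show n - 4 + 2 = n - 2 by omega, show n - 4 + 1 = n - 3 by omega] at h
  have h2 : ∀ t, evenIntegrand (verticalSlice f) θ s t =
      2 * ((Real.log |t - s| : ℂ) * iteratedDeriv (n - 2) (radon hf.density θ) t) := by
    intro t
    rw [evenIntegrand, hf.iteratedDeriv_weighted, Complex.real_smul]
    ring
  simp only [evenKernel, h2]
  rw [intervalIntegral.integral_const_mul, h]
  ring

theorem intervalIntegrable_evenIntegrand {𝕜 : Type*} [RCLike 𝕜]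
    {f : sphere (0 : EuclideanSpace ℝ (Fin (n + 1))) 1 → 𝕜}
    {θ : sphere (0 : EuclideanSpace ℝ (Fin n)) 1}
    (hw : ContDiff ℝ ∞ (weighted (verticalSlice f) θ)) (s : ℝ) :
    IntervalIntegrable (evenIntegrand (verticalSlice f) θ s) volume (-1) 1 := by
  have hlog : IntervalIntegrable (fun t => Real.log |t - s|) volume (-1) 1 := by
    simp only [Real.log_abs]
    have := (intervalIntegral.intervalIntegrable_log' (a := -1 - s) (b := 1 - s)).comp_sub_right s
    simpa using this
  exact hlog.smul_continuousOn ((contDiff_infty.1 hw (n - 2)).continuous_iteratedDeriv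
    (n - 2) le_rfl).continuousOn

/-- With n = 2k+3, 8π²c = 4(2π)^{n-1}(-1)^k, and λ_n carries the same sign (-1)^k. -/
theorem IsSmoothEvenVanishing.odd_inversion (hf : IsSmoothEvenVanishing f) (hn : 2 < n)
    (hodd : Odd n) (x : sphere (0 : EuclideanSpace ℝ (Fin (n + 1))) 1) :
    f x = (inversionConst n * |x.1 (Fin.last n)|) •
      -(Laplacian.laplacian (backprojection (oddKernel (verticalSlice f)))
        (horizontalPart x.1)) := by
  obtain ⟨k, rfl⟩ : ∃ k, n = 2 * k + 3 := by
    obtain ⟨m, rfl⟩ := hodd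
    exact ⟨m - 1, by omega⟩
  rw [(backprojection_const_mul_rieszRay hn hf.density _ (hf.oddKernel_eq hn hodd)).2.2,
    hf.density_apply]
  nth_rewrite 1 [hf.apply_eq_projectedDensity x]
  have h := congrArg (fun r : ℝ => (r : ℂ)) (inversionConst_mul hn)
  simp only [show 2 * k + 3 - 1 = 2 * k + 2 by omega, show (2 * k + 3) / 2 - 1 = k by omega] at h
  push_cast at h
  have hI : (Complex.I) ^ (2 * k) = (-1) ^ k := by rw [pow_mul, Complex.I_sq]
  have hone : ((-1 : ℂ) ^ k) * (-1) ^ k = 1 := by rw [← mul_pow]; simp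
  simp only [show 2 * k + 3 - 3 = 2 * k by omega, mul_pow, hI, Complex.real_smul]
  push_cast
  linear_combination (-(|x.1 (Fin.last (2 * k + 3))| : ℝ) *
    projectedDensity f (horizontalPart x.1) : ℂ) * (hone + (-1 : ℂ) ^ k * h)

/-- With n = 2k+4, -8π²c/π = 4(2π)^{n-1}(-1)^{k+1}. The sign of λ_n is now (-1)^{k+1}, so the
Laplacian appears without a minus. -/
theorem IsSmoothEvenVanishing.even_inversion (hf : IsSmoothEvenVanishing f) (hn : 2 < n)
    (heven : Even n) (x : sphere (0 : EuclideanSpace ℝ (Fin (n + 1))) 1) :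
    f x = (inversionConst n / Real.pi * |x.1 (Fin.last n)|) •
      Laplacian.laplacian (backprojection (evenKernel (verticalSlice f)))
        (horizontalPart x.1) := by
  obtain ⟨k, rfl⟩ : ∃ k, n = 2 * k + 4 := by
    obtain ⟨m, rfl⟩ := heven
    exact ⟨m - 2, by omega⟩
  rw [(backprojection_const_mul_rieszRay hn hf.density _ (hf.evenKernel_eq hn heven)).2.2,
    hf.density_apply]
  nth_rewrite 1 [hf.apply_eq_projectedDensity x]
  have h := congrArg (fun r : ℝ => (r : ℂ)) (inversionConst_mul hn)
  simp only [show 2 * k + 4 - 1 = 2 * k + 3 by omega, show (2 * k + 4) / 2 - 1 = k + 1 by omega] at h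
  push_cast at h
  have hI : (Complex.I) ^ (2 * k) = (-1) ^ k := by rw [pow_mul, Complex.I_sq]
  have hone : ((-1 : ℂ) ^ k) * (-1) ^ k = 1 := by rw [← mul_pow]; simp
  have hπ : (Real.pi : ℂ) ≠ 0 := by exact_mod_cast Real.pi_ne_zero
  simp only [show 2 * k + 4 - 4 = 2 * k by omega, mul_pow, hI, Complex.real_smul]
  push_cast
  field_simp
  linear_combination (-(|x.1 (Fin.last (2 * k + 4))| : ℝ) *
    projectedDensity f (horizontalPart x.1) : ℂ) * (hone - (-1 : ℂ) ^ k * h)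

end Inversion

/-! ### From complex to general scalars -/

section Transfer

variable {n : ℕ} {𝕜 : Type*} [RCLike 𝕜]

/-- The canonical embedding of `𝕜` into `ℂ` as a real-linear isometry. -/
noncomputable def complexEmbedding (𝕜 : Type*) [RCLike 𝕜] : 𝕜 →ₗᵢ[ℝ] ℂ where
  toLinearMap := (RCLike.map 𝕜 ℂ).toLinearMap
  norm_map' z := by
    rw [← sq_eq_sq₀ (norm_nonneg _) (norm_nonneg _), RCLike.norm_sq_eq_def (z := z),
      Complex.sq_norm, Complex.normSq_apply]
    simp

theorem map_complexEmbedding (z : 𝕜) : RCLike.map ℂ 𝕜 (complexEmbedding 𝕜 z) = z := by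
  have h : complexEmbedding 𝕜 z = RCLike.re z + RCLike.im z * Complex.I := by
    change RCLike.map 𝕜 ℂ z = _
    simp
  rw [h, RCLike.map_apply]
  simp

variable {f : sphere (0 : EuclideanSpace ℝ (Fin (n + 1))) 1 → 𝕜}

theorem IsSmoothEvenVanishing.complexify (hf : IsSmoothEvenVanishing f) :
    IsSmoothEvenVanishing (fun x => complexEmbedding 𝕜 (f x)) where
  smooth := (complexEmbedding 𝕜).toContinuousLinearMap.contDiff.contMDiff.comp hf.smooth
  even x y h1 h2 := by rw [hf.even x y h1 h2]
  vanishing := by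
    obtain ⟨U, hU, hUe, hUf⟩ := hf.vanishing
    exact ⟨U, hU, hUe, fun x hx => by rw [hUf x hx, map_zero]⟩

theorem weighted_eq_map (f : sphere (0 : EuclideanSpace ℝ (Fin (n + 1))) 1 → 𝕜)
    (θ : sphere (0 : EuclideanSpace ℝ (Fin n)) 1) :
    weighted (verticalSlice f) θ = RCLike.map ℂ 𝕜 ∘
      weighted (verticalSlice fun x => complexEmbedding 𝕜 (f x)) θ := by
  ext t
  -- Isometries commute with the Bochner integral without any integrability assumption; the left
  -- inverse is then applied outside the integral.
  have h : verticalSlice (fun x => complexEmbedding 𝕜 (f x)) θ t =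
      complexEmbedding 𝕜 (verticalSlice f θ t) := (complexEmbedding 𝕜).integral_comp_comm f
  rw [Function.comp_apply, weighted, weighted, h, map_smul, map_complexEmbedding]

theorem iteratedDeriv_weighted_eq_map (hf : IsSmoothEvenVanishing f)
    (θ : sphere (0 : EuclideanSpace ℝ (Fin n)) 1) (k : ℕ) (t : ℝ) :
    iteratedDeriv k (weighted (verticalSlice f) θ) t = RCLike.map ℂ 𝕜
      (iteratedDeriv k (weighted (verticalSlice fun x => complexEmbedding 𝕜 (f x)) θ) t) := by
  have h := contDiff_infty.1 (hf.complexify.contDiff_weighted θ) k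
  rw [weighted_eq_map, iteratedDeriv, ContinuousLinearMap.iteratedFDeriv_comp_left _
    h.contDiffAt le_rfl]
  rfl

/-- The map back to 𝕜 need not be injective, so here integrability is needed to pull it through the
integral, and C² regularity to pull it through the Laplacian. -/
theorem backprojection_map {K : sphere (0 : EuclideanSpace ℝ (Fin n)) 1 → ℝ → 𝕜}
    {L : sphere (0 : EuclideanSpace ℝ (Fin n)) 1 → ℝ → ℂ}
    (hKL : ∀ θ s, K θ s = RCLike.map ℂ 𝕜 (L θ s))
    (hL : ∀ p : EuclideanSpace ℝ (Fin n),
      Integrable (fun θ : sphere (0 : EuclideanSpace ℝ (Fin n)) 1 => L θ (inner ℝ θ.1 p))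
        (surfaceMeasure (EuclideanSpace ℝ (Fin n))))
    (hB : ContDiff ℝ 2 (backprojection L)) :
    (∀ p : EuclideanSpace ℝ (Fin n),
      Integrable (fun θ : sphere (0 : EuclideanSpace ℝ (Fin n)) 1 => K θ (inner ℝ θ.1 p))
        (surfaceMeasure (EuclideanSpace ℝ (Fin n)))) ∧
    ContDiff ℝ 2 (backprojection K) ∧
    ∀ p, Laplacian.laplacian (backprojection K) p =
      RCLike.map ℂ 𝕜 (Laplacian.laplacian (backprojection L) p) := by
  have h : backprojection K = RCLike.map ℂ 𝕜 ∘ backprojection L := by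
    ext p
    simp only [backprojection, hKL, Function.comp_apply]
    exact (RCLike.map ℂ 𝕜).integral_comp_comm (hL p)
  refine ⟨fun p => ?_, ?_, fun p => ?_⟩
  · simp only [hKL]
    exact (RCLike.map ℂ 𝕜).integrable_comp (hL p)
  · rw [h]
    exact (RCLike.map ℂ 𝕜).contDiff.comp hB
  · rw [h, hB.contDiffAt.laplacian_CLM_comp_left]
    rfl

end Transfer

end VerticalSlice

/-! ### The inversion theorem -/

theorem theorem3p4 {𝕜 : Type*} [RCLike 𝕜] (n : ℕ) (hn : 2 < n)
    (f : sphere (0 : EuclideanSpace ℝ (Fin (n + 1))) 1 → 𝕜)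
    (hf : VerticalSlice.IsSmoothEvenVanishing f) :
    (∀ θ, ContDiff ℝ ∞ (VerticalSlice.weighted (VerticalSlice.verticalSlice f) θ)) ∧
    (Odd n →
      (∀ p : EuclideanSpace ℝ (Fin n),
        Integrable (fun θ : sphere (0 : EuclideanSpace ℝ (Fin n)) 1 =>
          VerticalSlice.oddKernel (VerticalSlice.verticalSlice f) θ (inner ℝ θ.1 p))
          (VerticalSlice.surfaceMeasure (EuclideanSpace ℝ (Fin n)))) ∧
      ContDiff ℝ 2 (VerticalSlice.backprojection
        (VerticalSlice.oddKernel (VerticalSlice.verticalSlice f))) ∧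
      ∀ x : sphere (0 : EuclideanSpace ℝ (Fin (n + 1))) 1,
        f x = (VerticalSlice.inversionConst n * |x.1 (Fin.last n)|) •
          -(Laplacian.laplacian (VerticalSlice.backprojection
              (VerticalSlice.oddKernel (VerticalSlice.verticalSlice f)))
            (VerticalSlice.horizontalPart x.1))) ∧
    (Even n →
      (∀ (θ : sphere (0 : EuclideanSpace ℝ (Fin n)) 1) (s : ℝ),
        IntervalIntegrable
          (VerticalSlice.evenIntegrand (VerticalSlice.verticalSlice f) θ s) volume (-1) 1) ∧
      (∀ p : EuclideanSpace ℝ (Fin n),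
        Integrable (fun θ : sphere (0 : EuclideanSpace ℝ (Fin n)) 1 =>
          VerticalSlice.evenKernel (VerticalSlice.verticalSlice f) θ (inner ℝ θ.1 p))
          (VerticalSlice.surfaceMeasure (EuclideanSpace ℝ (Fin n)))) ∧
      ContDiff ℝ 2 (VerticalSlice.backprojection
        (VerticalSlice.evenKernel (VerticalSlice.verticalSlice f))) ∧
      ∀ x : sphere (0 : EuclideanSpace ℝ (Fin (n + 1))) 1,
        f x = (VerticalSlice.inversionConst n / Real.pi * |x.1 (Fin.last n)|) •
          Laplacian.laplacian (VerticalSlice.backprojection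
              (VerticalSlice.evenKernel (VerticalSlice.verticalSlice f)))
            (VerticalSlice.horizontalPart x.1)) := by
  have hc := hf.complexify
  refine ⟨fun θ => ?_, fun hodd => ?_, fun heven => ?_⟩
  · rw [VerticalSlice.weighted_eq_map]
    exact (RCLike.map ℂ 𝕜).contDiff.comp (hc.contDiff_weighted θ)
  · obtain ⟨hi, hB, -⟩ := VerticalSlice.backprojection_const_mul_rieszRay hn hc.density _
      (hc.oddKernel_eq hn hodd)
    obtain ⟨hi', hB', hΔ⟩ := VerticalSlice.backprojection_map
      (K := VerticalSlice.oddKernel (VerticalSlice.verticalSlice f))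
      (L := VerticalSlice.oddKernel (VerticalSlice.verticalSlice
        fun x => VerticalSlice.complexEmbedding 𝕜 (f x)))
      (fun θ s => VerticalSlice.iteratedDeriv_weighted_eq_map hf θ (n - 3) s) hi hB
    refine ⟨hi', hB', fun x => ?_⟩
    have h := congrArg (RCLike.map ℂ 𝕜) (hc.odd_inversion hn hodd x)
    rw [VerticalSlice.map_complexEmbedding, map_smul, map_neg] at h
    rw [hΔ, h]
  · have hw : ∀ θ, ContDiff ℝ ∞ (VerticalSlice.weighted (VerticalSlice.verticalSlice f) θ) :=
      fun θ => by
        rw [VerticalSlice.weighted_eq_map]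
        exact (RCLike.map ℂ 𝕜).contDiff.comp (hc.contDiff_weighted θ)
    obtain ⟨hi, hB, -⟩ := VerticalSlice.backprojection_const_mul_rieszRay hn hc.density _
      (hc.evenKernel_eq hn heven)
    -- The even kernel contains one more integral, in t; pulling the map through it uses
    -- integrability of the logarithm against a continuous function.
    have hK : ∀ θ s, VerticalSlice.evenKernel (VerticalSlice.verticalSlice f) θ s =
        RCLike.map ℂ 𝕜 (VerticalSlice.evenKernel (VerticalSlice.verticalSlice
          fun x => VerticalSlice.complexEmbedding 𝕜 (f x)) θ s) := fun θ s => by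
      simp only [VerticalSlice.evenKernel]
      rw [← ContinuousLinearMap.intervalIntegral_comp_comm _
        (VerticalSlice.intervalIntegrable_evenIntegrand (hc.contDiff_weighted θ) s)]
      simp only [VerticalSlice.evenIntegrand, map_smul,
        VerticalSlice.iteratedDeriv_weighted_eq_map hf]
    obtain ⟨hi', hB', hΔ⟩ := VerticalSlice.backprojection_map hK hi hB
    refine ⟨fun θ s => VerticalSlice.intervalIntegrable_evenIntegrand (hw θ) s, hi', hB',
      fun x => ?_⟩
    have h := congrArg (RCLike.map ℂ 𝕜) (hc.even_inversion hn heven x)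
    rw [VerticalSlice.map_complexEmbedding, map_smul] at h
    rw [hΔ, h]
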